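/- **Manifolds with periodic ends.** Let $X$ be a connected smooth $n$-manifold (Hausdorff, second countable, without boundary) with finitely many periodic ends $e\in\mathfrak E$. This means that the following data are given. For every $e\in\mathfrak E$ there is a connected, non-compact smooth $n$-manifold $W_e$ together with: * a compact set $C_e\subset W_e$ such that $W_e\setminus C_e$ has two connected components $N_{e,+}$, $N_{e,-}$; * a compact set $C_{e,+}\subset N_{e,+}$ such that $N_{e,+}\setminus C_{e,+}$ has two components $N_{e,++}$, $N_{e,+-}$, and $W_e\setminus C_{e,+}$ is the topological disjoint union of $N_{e,-}\cup C_e\cup N_{e,+-}$ and $N_{e,++}$; * a compact set $C_{e,-}\subset N_{e,-}$ such that $N_{e,-}\setminus C_{e,-}$ is the topological disjoint union of $N_{e,--}$ and $N_{e,-+}$, and $W_e\setminus C_{e,-}$ is the topological disjoint union of $N_{e,--}$ and $N_{e,-+}\cup C_e\cup N_{e,+}$; * a diffeomorphism $i_e:N_{e,+}\to N_{e,-}$ with $i_e(N_{e,++})=N_{e,-+}$ and $i_e(N_{e,+-})=N_{e,--}$, such that the quotient $Y_e$ of $W_e$ by $x\sim i_e(x)$ ($x\in N_{e,+}$) is compact.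 The manifold $X$ is obtained from an open piece $K\subset X$ by attaching, for each $e$, copies $W_{e,0},W_{e,1},\dots$ of $W_e$: the copy $W_{e,0}$ is glued to $K$ along an open set $N_e\subset K$ which is identified with $N_{e,-}\subset W_e$, and $N_{e,+}\subset W_{e,k}$ is glued to $N_{e,-}\subset W_{e,k+1}$ by $i_e$ for every $k\ge 0$; there are no other identifications. The set $K\setminus\bigcup_e N_e$ is compact, and $(K\setminus \bigcup_e N_e)\cup\bigcup_e N_{e,0-}$ is open and connected, where $N_{e,0-}\subset N_e$ corresponds to $N_{e,--}$. **The function $\tau$.** Let $\tau=\sum_{e\in\mathfrak E}\tau_e$, where $\tau_e:X\to\mathbb R$ is smooth, is given on each copy $W_{e,k}$ ($k\ge0$) by $f_e+k$ for a fixed smooth function $f_e:W_e\to\mathbb R$, and, for every $e'\ne e$, vanishes on $W_{e',k}$ for all sufficiently large $k$. Put $X^{\le a}=\{x\in X : \tau(x)\le a\}$. Homology and cohomology are singular, and $\mathrm{Tors}$ denotes the torsion subgroup of $H_1(X,\mathbb Z)$. **Statement.** Suppose that $H_1(W_e,\mathbb Z)$ is a torsion group for every $e\in\mathfrak E$. Then: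 1. For every such $\tau$ there is $a_0\ge 0$ such that for all $a\ge a_0$ (in particular for every regular value $a\ge a_0$ of $\tau$) the composition $$H_1(X^{\le a},\mathbb Z)\to H_1(X,\mathbb Z)\to H_1(X,\mathbb Z)/\mathrm{Tors}$$ is surjective. 2. $H_1(X,\mathbb Z)/\mathrm{Tors}$ is finitely generated. 3. Evaluation of cocycles on cycles induces isomorphisms $$H^1(X,\mathbb Z)\cong\mathrm{Hom}(H_1(X,\mathbb Z)/\mathrm{Tors},\mathbb Z),\qquad H^1(X,\mathbb R)\cong\mathrm{Hom}(H_1(X,\mathbb Z)/\mathrm{Tors},\mathbb R).$$ 4. The natural map $H^1(X,\mathbb Z)\otimes_{\mathbb Z}\mathbb R\to H^1(X,\mathbb R)$ is an isomorphism. 5. $H^1(X,2\pi i\mathbb Z)$ is a lattice in the finite-dimensional real vector space $H^1(X,i\mathbb R)$: the natural map $H^1(X,2\pi i\mathbb Z)\to H^1(X,i\mathbb R)$ is injective, and its image is the $\mathbb Z$-span of an $\mathbb R$-basis of $H^1(X,i\mathbb R)$. -/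

import Mathlib

open scoped Manifold ContDiff Topology TensorProduct

universe u v

noncomputable section

/-! ### Singular homology and cohomology in degree one -/

namespace PeriodicEnds

/-- The singular chain complex of `X` with integer coefficients (`ULift ℤ` is `ℤ` placed in the
universe of `X`). -/
abbrev singularChains (X : Type u) [TopologicalSpace X] : ChainComplex (ModuleCat.{u} ℤ) ℕ :=
  ((AlgebraicTopology.singularChainComplexFunctor (ModuleCat.{u} ℤ)).obj
    (ModuleCat.of ℤ (ULift.{u} ℤ))).obj (TopCat.of X)

/-- The singular homology group `H₁(X, ℤ)`. -/
abbrev H₁ (X : Type u) [TopologicalSpace X] : Type u :=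
  ↑((singularChains X).homology 1)

/-- The homomorphism `H₁(X, ℤ) → H₁(Y, ℤ)` induced by a continuous map. -/
def H₁.map {X Y : Type u} [TopologicalSpace X] [TopologicalSpace Y] (f : C(X, Y)) :
    H₁ X →ₗ[ℤ] H₁ Y :=
  (((AlgebraicTopology.singularHomologyFunctor (ModuleCat.{u} ℤ) 1).obj
    (ModuleCat.of ℤ (ULift.{u} ℤ))).map (TopCat.ofHom f)).hom

/-- The quotient `H₁(X, ℤ) / Tors`. -/
abbrev H₁ModTors (X : Type u) [TopologicalSpace X] : Type u :=
  H₁ X ⧸ Submodule.torsion ℤ (H₁ X)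

/-- Singular `k`-cochains with values in `A`. -/
abbrev Cochain (X : Type u) [TopologicalSpace X] (A : Type v) [AddCommGroup A] (k : ℕ) :
    Type (max u v) :=
  ((singularChains X).X k) →ₗ[ℤ] A

section Cohomology

variable (R : Type) [CommRing R] (X : Type u) [TopologicalSpace X]
  (A : Type v) [AddCommGroup A] [Module R A]

/-- The coboundary `c ↦ c ∘ ∂`. -/
def coboundary (k : ℕ) : Cochain X A k →ₗ[R] Cochain X A (k + 1) where
  toFun c := c ∘ₗ ((singularChains X).d (k + 1) k).hom
  map_add' _ _ := rfl
  map_smul' _ _ := rfl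

/-- Singular `1`-cocycles. -/
abbrev cocycles₁ : Submodule R (Cochain X A 1) := LinearMap.ker (coboundary R X A 1)

/-- Singular `1`-coboundaries, as a submodule of the `1`-cocycles. -/
abbrev coboundaries₁ : Submodule R (cocycles₁ R X A) :=
  (LinearMap.range (coboundary R X A 0)).submoduleOf (cocycles₁ R X A)

/-- The singular cohomology group `H¹(X, A)`, with the `R`-module structure coming from that of the
coefficient module `A`. -/
abbrev Cohomology₁ : Type (max u v) := cocycles₁ R X A ⧸ coboundaries₁ R X A

variable {A}

/-- The homomorphism `H¹(X, A) → H¹(X, B)` induced by a homomorphism `A → B` of coefficient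
groups, where `B` is an `R`-module. -/
def coeffMap {B : Type v} [AddCommGroup B] [Module R B] {A : Type v} [AddCommGroup A]
    (g : A →ₗ[ℤ] B) : Cohomology₁ ℤ X A →ₗ[ℤ] Cohomology₁ R X B :=
  Submodule.liftQ (coboundaries₁ ℤ X A)
    (AddMonoidHom.toIntLinearMap
      { toFun := fun c => (coboundaries₁ R X B).mkQ ⟨g ∘ₗ c.1, by
          have h : c.1 ∘ₗ ((singularChains X).d 2 1).hom = 0 := c.2
          change (g ∘ₗ c.1) ∘ₗ ((singularChains X).d 2 1).hom = 0
          rw [LinearMap.comp_assoc, h, LinearMap.comp_zero]⟩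
        map_zero' := by
          rw [← map_zero (coboundaries₁ R X B).mkQ]
          congr 1
          ext1
          exact LinearMap.comp_zero _
        map_add' := fun c d => by
          rw [← map_add]
          congr 1
          ext1
          exact LinearMap.comp_add _ _ _ })
    (by
      rintro ⟨c, hc⟩ ⟨b, hb⟩
      have hb' : b ∘ₗ ((singularChains X).d 1 0).hom = c := hb
      change (coboundaries₁ R X B).mkQ _ = 0
      rw [Submodule.mkQ_apply, Submodule.Quotient.mk_eq_zero]
      refine ⟨g ∘ₗ b, ?_⟩
      change (g ∘ₗ b) ∘ₗ ((singularChains X).d 1 0).hom = g ∘ₗ c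
      rw [LinearMap.comp_assoc, hb'])

variable (A)

/-- Evaluation of cocycles on cycles induces an isomorphism `H¹(X, A) ≃ Hom(H₁(X, ℤ) / Tors, A)`. -/
def EvaluationIsIso : Prop :=
  ∃ Ψ : Cohomology₁ R X A ≃ₗ[R] (H₁ModTors X →ₗ[ℤ] A),
    ∀ (c : cocycles₁ R X A) (z : (singularChains X).cycles 1),
      Ψ (Submodule.Quotient.mk c)
          (Submodule.Quotient.mk (((singularChains X).homologyπ 1).hom z)) =
        c.1 (((singularChains X).iCycles 1).hom z)

end Cohomology

/-- The natural map `ℝ ⊗ H¹(X, ℤ) → H¹(X, ℝ)`, `r ⊗ c ↦ r • c`. -/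
def tensorMap (X : Type u) [TopologicalSpace X] :
    ℝ ⊗[ℤ] Cohomology₁ ℤ X ℤ →ₗ[ℝ] Cohomology₁ ℝ X ℝ :=
  (coeffMap ℝ X (Algebra.linearMap ℤ ℝ)).liftBaseChange ℝ

/-- The real line `iℝ ⊆ ℂ`. -/
def imaginaryLine : Submodule ℝ ℂ := Submodule.span ℝ {Complex.I}

/-- The group `2πiℤ ⊆ ℂ`. -/
def twoPiIInt : Submodule ℤ ℂ := Submodule.span ℤ {2 * Real.pi * Complex.I}

theorem twoPiIInt_le : twoPiIInt ≤ imaginaryLine.restrictScalars ℤ := by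
  refine Submodule.span_le.2 ?_
  rintro _ rfl
  refine Submodule.mem_span_singleton.2 ⟨2 * Real.pi, ?_⟩
  simp

/-- The inclusion `2πiℤ → iℝ`. -/
def twoPiIIntInclusion : twoPiIInt →ₗ[ℤ] imaginaryLine where
  toFun z := ⟨z.1, twoPiIInt_le z.2⟩
  map_add' _ _ := rfl
  map_smul' _ _ := by ext1; simp

/-! ### Manifolds with periodic ends -/

/-- The periodicity data on a manifold `W`: a compact set `C` whose complement has the two
components `Npos` and `Nneg`, compact sets `Cpos ⊆ Npos` and `Cneg ⊆ Nneg` which cut these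
components into an outer and an inner piece each, and a diffeomorphism `glue : Npos → Nneg`
matching the pieces.

An open set that is the union of two disjoint connected open sets has exactly these two sets as its
components, which is how "has the two components" is expressed. -/
structure PeriodicSegment (n : ℕ) (W : Type v) [TopologicalSpace W]
    [ChartedSpace (EuclideanSpace ℝ (Fin n)) W] where
  /-- the compact core -/
  C : Set W
  /-- `N₊` -/
  Npos : TopologicalSpace.Opens W
  /-- `N₋` -/
  Nneg : TopologicalSpace.Opens W
  isCompact_C : IsCompact C
  isConnected_Npos : IsConnected (Npos : Set W)
  isConnected_Nneg : IsConnected (Nneg : Set W)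
  disjoint_Npos_Nneg : Disjoint (Npos : Set W) Nneg
  compl_C : Cᶜ = (Npos : Set W) ∪ Nneg
  /-- `C₊ ⊆ N₊` -/
  Cpos : Set W
  /-- `N₊₊`, the outer part of `N₊` -/
  Npp : Set W
  /-- `N₊₋`, the inner part of `N₊` -/
  Npm : Set W
  isCompact_Cpos : IsCompact Cpos
  Cpos_subset : Cpos ⊆ Npos
  isOpen_Npp : IsOpen Npp
  isOpen_Npm : IsOpen Npm
  isConnected_Npp : IsConnected Npp
  isConnected_Npm : IsConnected Npm
  disjoint_Npp_Npm : Disjoint Npp Npm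
  Npos_diff_Cpos : (Npos : Set W) \ Cpos = Npp ∪ Npm
  /-- `W \ C₊` is the topological disjoint union of `N₋ ∪ C ∪ N₊₋` and `N₊₊`. -/
  isOpen_inner_pos : IsOpen ((Nneg : Set W) ∪ C ∪ Npm)
  /-- `C₋ ⊆ N₋` -/
  Cneg : Set W
  /-- `N₋₋`, the outer part of `N₋` -/
  Nmm : Set W
  /-- `N₋₊`, the inner part of `N₋` -/
  Nmp : Set W
  isCompact_Cneg : IsCompact Cneg
  Cneg_subset : Cneg ⊆ Nneg
  isOpen_Nmm : IsOpen Nmm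
  isOpen_Nmp : IsOpen Nmp
  disjoint_Nmm_Nmp : Disjoint Nmm Nmp
  Nneg_diff_Cneg : (Nneg : Set W) \ Cneg = Nmm ∪ Nmp
  /-- `W \ C₋` is the topological disjoint union of `N₋₋` and `N₋₊ ∪ C ∪ N₊`. -/
  isOpen_inner_neg : IsOpen (Nmp ∪ C ∪ (Npos : Set W))
  /-- the diffeomorphism `N₊ → N₋` -/
  glue : Npos ≃ₘ^∞⟮𝓡 n, 𝓡 n⟯ Nneg
  /-- it maps `N₊₊` onto `N₋₊` -/
  glue_Npp : ∀ x : Npos, (glue x : W) ∈ Nmp ↔ (x : W) ∈ Npp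
  /-- it maps `N₊₋` onto `N₋₋` -/
  glue_Npm : ∀ x : Npos, (glue x : W) ∈ Nmm ↔ (x : W) ∈ Npm
  /-- the generalized torus `Y = W / ∼`, where `x ∼ glue x` for `x ∈ N₊`, is closed -/
  compactSpace_torus :
    CompactSpace (Quot fun x y : W => ∃ h : x ∈ Npos, (glue ⟨x, h⟩ : W) = y)

/-- The structure of a manifold with periodic ends on `X`, with finite set of ends `E` and
periodicity data `S e` on `W e`: a diffeomorphism of `X` with the manifold obtained from an open
piece `K` by attaching, for each `e`, infinitely many copies of `W e`, the `0`-th copy being glued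
to `K` along `N₋` and the `(k+1)`-st one to the `k`-th one by `glue : N₊ → N₋`.

It is given by `K` as an open subset of `X` and by the open embeddings `φ e k : W e → X` of the
copies; these sets cover `X` and overlap exactly as prescribed by the gluing. The set `N e ⊆ K`
along which the first copy is glued is the image of `N₋` under `φ e 0`, and the sets which cut it
into two pieces are the images of `C₋`, `N₋₋` and `N₋₊`. -/
structure PeriodicEndStructure (n : ℕ) (X : Type u) [TopologicalSpace X]
    [ChartedSpace (EuclideanSpace ℝ (Fin n)) X] {E : Type} {W : E → Type v}
    [∀ e, TopologicalSpace (W e)] [∀ e, ChartedSpace (EuclideanSpace ℝ (Fin n)) (W e)]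
    (S : ∀ e, PeriodicSegment n (W e)) where
  /-- the open piece `K` -/
  K : TopologicalSpace.Opens X
  /-- `φ e k` embeds `W e` as the `k`-th copy in the end `e` -/
  φ : ∀ e, ℕ → W e → X
  isLocalDiffeomorph_φ : ∀ e k, IsLocalDiffeomorph (𝓡 n) (𝓡 n) ∞ (φ e k)
  injective_φ : ∀ e k, Function.Injective (φ e k)
  cover : (K : Set X) ∪ ⋃ e, ⋃ k, Set.range (φ e k) = Set.univ
  /-- different ends are disjoint -/
  disjoint_ends : ∀ e e' k k', e ≠ e' → Disjoint (Set.range (φ e k)) (Set.range (φ e' k'))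
  /-- consecutive copies are glued by `N₊ → N₋` -/
  φ_eq_φ_succ_iff : ∀ e k x y,
    φ e k x = φ e (k + 1) y ↔ ∃ h : x ∈ (S e).Npos, ((S e).glue ⟨x, h⟩ : W e) = y
  /-- non-consecutive copies are disjoint -/
  disjoint_copies : ∀ e k k', k + 2 ≤ k' → Disjoint (Set.range (φ e k)) (Set.range (φ e k'))
  /-- `K` is glued to the first copy along `N₋` -/
  K_inter_zero : ∀ e, (K : Set X) ∩ Set.range (φ e 0) = φ e 0 '' (S e).Nneg
  /-- `K` is disjoint from the other copies -/
  K_inter_succ : ∀ e k, Disjoint (K : Set X) (Set.range (φ e (k + 1)))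
  isCompact_K_diff_N : IsCompact ((K : Set X) \ ⋃ e, φ e 0 '' (S e).Nneg)
  /-- `(K \ N) ∪ N₀₋` is a component of `K \ C₀`; the other ones are the images of the `N₋₊`. -/
  isOpen_K_inner :
    IsOpen (((K : Set X) \ ⋃ e, φ e 0 '' (S e).Nneg) ∪ ⋃ e, φ e 0 '' (S e).Nmm)
  isConnected_K_inner :
    IsConnected (((K : Set X) \ ⋃ e, φ e 0 '' (S e).Nneg) ∪ ⋃ e, φ e 0 '' (S e).Nmm)

/-- `τ = ∑ e, τ e`, where `τ e` is a smooth function on `X` which on the end `e` is the restriction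
of a smooth function on the infinite cyclic cover of the generalized torus that increases by `1`
under the generator of the deck group (so it is `f + k` on the `k`-th copy of `W e`, for a smooth
`f` on `W e`), and which vanishes far out on the other ends. -/
def PeriodicEndStructure.IsEndFunction {n : ℕ} {X : Type u} [TopologicalSpace X]
    [ChartedSpace (EuclideanSpace ℝ (Fin n)) X] {E : Type} [Fintype E] {W : E → Type v}
    [∀ e, TopologicalSpace (W e)] [∀ e, ChartedSpace (EuclideanSpace ℝ (Fin n)) (W e)]
    {S : ∀ e, PeriodicSegment n (W e)} (P : PeriodicEndStructure n X S) (τ : X → ℝ) : Prop :=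
  ∃ τ' : E → X → ℝ,
    (∀ e, ContMDiff (𝓡 n) 𝓘(ℝ, ℝ) ∞ (τ' e)) ∧
    (∀ e, ∃ f : W e → ℝ, ContMDiff (𝓡 n) 𝓘(ℝ, ℝ) ∞ f ∧ ∀ k w, τ' e (P.φ e k w) = f w + k) ∧
    (∀ e e', e' ≠ e → ∃ k₀, ∀ k ≥ k₀, ∀ w, τ' e (P.φ e' k w) = 0) ∧
    ∀ x, τ x = ∑ e, τ' e x

end PeriodicEnds

end

/-! The heart of the matter is that `H₁(X) / Tors` is finitely generated. Work in `ReducedChains X`,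
the 1-chains modulo those having a nonzero multiple that is a boundary; `H₁(X) / Tors` is the image
of the cycles there. Call `s` a potential on `U` if every path in `U` has class `s (end) - s
(start)`. Two potentials on an open set differ by a function that is constant along paths.

A copy of `W e` has a potential, since its first homology is torsion: integrate from a base point
(`exists_isPotential_range`). Consecutive copies in an end meet in a copy of the connected set `N₊`,
and non-consecutive ones do not meet, so the potentials can be matched one copy after another by
adding constants (`exists_isPotential_iUnion_nat`). Hence each entire end has a potential, although
it consists of infinitely many pieces. The ends leave uncovered only a part of the compact set `K \
N`, which is covered by finitely many small balls, and these have potentials too.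

After shrinking this finite cover, the differences of potentials on overlaps take finitely many
values (`exists_fg_of_isCompact`). Picking at each point one of the potentials gives a function `t`
such that every path has class `t (end) - t (start)` modulo the span of these values. For a cycle
the endpoint terms cancel, so its class lies in that finitely generated span (`exists_fg_of_cover`).

The rest is formal. Finitely many generators are carried by compact sets, on which `τ` is bounded.
Evaluation is an isomorphism by the universal coefficient argument for a path connected space and
torsion-free coefficients (`evaluationIsIso`). As `H₁(X) / Tors` is free of finite rank, bases of
integral cohomology map to bases of real cohomology (`exists_basis_coeffMap`). -/

noncomputable section

namespace PeriodicEnds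

open CategoryTheory AlgebraicTopology Simplicial

/-! ### Singular chains as a free module on singular simplices -/

/-- The standard topological `k`-simplex. -/
abbrev Simp (k : ℕ) : Type := stdSimplex ℝ (Fin (k + 1))

/-- The inclusion of the `i`-th face. -/
def face {k : ℕ} (i : Fin (k + 2)) : C(Simp k, Simp (k + 1)) :=
  ⟨stdSimplex.map i.succAbove, stdSimplex.continuous_map _⟩

/-- Singular chains, as formal sums of singular simplices. -/
abbrev Ch (X : Type u) [TopologicalSpace X] (k : ℕ) : Type u := C(Simp k, X) →₀ ℤ

/-- The boundary of formal sums of singular simplices. -/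
def bdry (X : Type u) [TopologicalSpace X] (k : ℕ) : Ch X (k + 1) →ₗ[ℤ] Ch X k :=
  Finsupp.linearCombination ℤ fun σ =>
    ∑ i : Fin (k + 2), (-1 : ℤ) ^ (i : ℕ) • Finsupp.single (σ.comp (face i)) 1

/-- The map on chains induced by a continuous map between spaces in arbitrary universes. -/
def chMap {X : Type u} [TopologicalSpace X] {Y : Type v} [TopologicalSpace Y] (f : C(X, Y))
    (k : ℕ) : Ch X k →ₗ[ℤ] Ch Y k :=
  Finsupp.lmapDomain ℤ ℤ fun σ => f.comp σ

section FormalChains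

variable {X : Type u} [TopologicalSpace X] {Y : Type v} [TopologicalSpace Y]

@[simp]
theorem bdry_single {k : ℕ} (σ : C(Simp (k + 1), X)) :
    bdry X k (Finsupp.single σ 1) =
      ∑ i : Fin (k + 2), (-1 : ℤ) ^ (i : ℕ) • Finsupp.single (σ.comp (face i)) 1 := by
  simp [bdry]

@[simp]
theorem chMap_single (f : C(X, Y)) {k : ℕ} (σ : C(Simp k, X)) (n : ℤ) :
    chMap f k (Finsupp.single σ n) = Finsupp.single (f.comp σ) n := by
  simp [chMap]

theorem bdry_chMap (f : C(X, Y)) {k : ℕ} (c : Ch X (k + 1)) :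
    bdry Y k (chMap f (k + 1) c) = chMap f k (bdry X k c) := by
  have : bdry Y k ∘ₗ chMap f (k + 1) = chMap f k ∘ₗ bdry X k := by
    ext1 σ
    ext1
    simp only [LinearMap.comp_apply, Finsupp.lsingle_apply, chMap_single, bdry_single, map_sum,
      map_smul, ContinuousMap.comp_assoc]
  exact LinearMap.congr_fun this c

/-- A chain all of whose simplices lie in the image of an embedding comes from a chain. -/
theorem exists_chMap_eq {f : C(X, Y)} (hf : Topology.IsEmbedding f) {k : ℕ} (c : Ch Y k)
    (hc : ∀ σ ∈ c.support, Set.range σ ⊆ Set.range f) : ∃ c', chMap f k c' = c := by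
  suffices h : c ∈ LinearMap.range (chMap f k) from h
  rw [← Finsupp.sum_single c]
  refine Submodule.sum_mem _ fun σ hσ => ?_
  have h := hc σ hσ
  let g : Simp k → X := fun t => (h ⟨t, rfl⟩).choose
  have hg : ∀ t, f (g t) = σ t := fun t => (h ⟨t, rfl⟩).choose_spec
  have hgc : Continuous g := by
    rw [hf.continuous_iff]
    exact σ.continuous.congr fun t => (hg t).symm
  refine ⟨Finsupp.single ⟨g, hgc⟩ (c σ), ?_⟩
  rw [chMap_single]
  congr 1
  ext t
  exact hg t

theorem chMap_injective {f : C(X, Y)} (hf : Function.Injective f) (k : ℕ) :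
    Function.Injective (chMap f k) :=
  Finsupp.mapDomain_injective fun _ _ h =>
    ContinuousMap.ext fun t => hf (ContinuousMap.congr_fun h t)

end FormalChains

section Chains

variable {X : Type u} [TopologicalSpace X]

/-- The `k`-simplices of the singular simplicial set are the singular `k`-simplices. -/
def simplexEquiv (X : Type u) [TopologicalSpace X] (k : ℕ) :
    (TopCat.toSSet.obj (TopCat.of X)) _⦋k⦌ ≃ C(Simp k, X) :=
  TopCat.toSSetObjEquiv (TopCat.of X) (.op ⦋k⦌)

/-- A singular simplex, as a chain. -/
def simplexChain {k : ℕ} (σ : C(Simp k, X)) : (singularChains X).X k :=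
  ((TopCat.toSSet.obj (TopCat.of X)).ιChainComplex (R := ModuleCat.of ℤ (ULift.{u} ℤ))
    ((simplexEquiv X k).symm σ)).hom ⟨1⟩

theorem d_simplexChain {k : ℕ} (σ : C(Simp (k + 1), X)) :
    ((singularChains X).d (k + 1) k).hom (simplexChain σ) =
      ∑ i : Fin (k + 2), (-1 : ℤ) ^ (i : ℕ) • simplexChain (σ.comp (face i)) := by
  have h := (TopCat.toSSet.obj (TopCat.of X)).ιChainComplex_d (R := ModuleCat.of ℤ (ULift.{u} ℤ))
    ((simplexEquiv X (k + 1)).symm σ)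
  have h2 := congrArg (fun f => f.hom ⟨1⟩) h
  refine h2.trans ?_
  simp only [ModuleCat.hom_sum, LinearMap.sum_apply]
  refine Finset.sum_congr rfl fun i _ => ?_
  rfl

/-- The chain module is a coproduct of copies of `ULift ℤ`, each generated by `⟨1⟩`. -/
theorem chain_hom_ext {k : ℕ} {M : ModuleCat.{u} ℤ} {f g : (singularChains X).X k ⟶ M}
    (h : ∀ σ, f.hom (simplexChain σ) = g.hom (simplexChain σ)) : f = g := by
  refine SSet.chainComplex_hom_ext fun x => ?_
  have := h (simplexEquiv X k x)
  simp only [simplexChain, Equiv.symm_apply_apply] at this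
  refine ModuleCat.hom_ext (LinearMap.ext fun n => ?_)
  have hn : n = n.down • (⟨1⟩ : ULift.{u} ℤ) := ULift.ext _ _ (by simp)
  rw [hn]
  refine (map_zsmul _ _ _).trans (Eq.trans ?_ (map_zsmul _ _ _).symm)
  exact congrArg (n.down • ·) this

/-- The coefficients of a chain. -/
def chainCoeff (X : Type u) [TopologicalSpace X] (k : ℕ) :
    (singularChains X).X k ⟶ ModuleCat.of ℤ (Ch X k) :=
  ((TopCat.toSSet.obj (TopCat.of X)).isColimitChainComplexXCofan
    (ModuleCat.of ℤ (ULift.{u} ℤ)) k).desc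
    (Limits.Cofan.mk _ fun x => ModuleCat.ofHom
      ((Finsupp.lsingle (simplexEquiv X k x)).comp ULift.moduleEquiv.toLinearMap))

theorem chainCoeff_simplexChain {k : ℕ} (σ : C(Simp k, X)) :
    (chainCoeff X k).hom (simplexChain σ) = Finsupp.single σ 1 := by
  have h := ((TopCat.toSSet.obj (TopCat.of X)).isColimitChainComplexXCofan
    (ModuleCat.of ℤ (ULift.{u} ℤ)) k).fac
    (Limits.Cofan.mk _ fun x => ModuleCat.ofHom
      ((Finsupp.lsingle (simplexEquiv X k x)).comp ULift.moduleEquiv.toLinearMap))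
    ⟨(simplexEquiv X k).symm σ⟩
  have h2 := congrArg (fun f => f.hom ⟨1⟩) h
  refine h2.trans ?_
  change Finsupp.single (simplexEquiv X k ((simplexEquiv X k).symm σ)) (1 : ℤ) = _
  rw [Equiv.apply_symm_apply]

/-- The singular chain groups are the groups of formal sums of singular simplices. -/
def chainEquiv (X : Type u) [TopologicalSpace X] (k : ℕ) :
    (singularChains X).X k ≃ₗ[ℤ] Ch X k :=
  LinearEquiv.ofLinearMap (chainCoeff X k).hom (Finsupp.linearCombination ℤ simplexChain)
    (by
      ext1 σ
      ext1
      simp only [LinearMap.comp_apply, Finsupp.lsingle_apply, Finsupp.linearCombination_single,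
        LinearMap.id_apply]
      rw [← chainCoeff_simplexChain]
      exact congrArg _ (@one_smul ℤ _ _ ((singularChains X).X k).isModule.toMulAction _))
    (by
      have : chainCoeff X k ≫ ModuleCat.ofHom (Finsupp.linearCombination ℤ simplexChain) =
          𝟙 ((singularChains X).X k) := by
        refine chain_hom_ext fun σ => ?_
        change Finsupp.linearCombination ℤ simplexChain ((chainCoeff X k).hom (simplexChain σ)) =
          simplexChain σ
        rw [chainCoeff_simplexChain, Finsupp.linearCombination_single]
        exact @one_smul ℤ _ _ ((singularChains X).X k).isModule.toMulAction _
      exact congrArg ModuleCat.Hom.hom this)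

@[simp]
theorem chainEquiv_simplexChain {k : ℕ} (σ : C(Simp k, X)) :
    chainEquiv X k (simplexChain σ) = Finsupp.single σ 1 :=
  chainCoeff_simplexChain σ

theorem chainEquiv_d {k : ℕ} (c : (singularChains X).X (k + 1)) :
    chainEquiv X k (((singularChains X).d (k + 1) k).hom c) =
      bdry X k (chainEquiv X (k + 1) c) := by
  have : (singularChains X).d (k + 1) k ≫ chainCoeff X k =
      chainCoeff X (k + 1) ≫ ModuleCat.ofHom (bdry X k) := by
    refine chain_hom_ext fun σ => ?_
    change chainEquiv X k (((singularChains X).d (k + 1) k).hom (simplexChain σ)) =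
      bdry X k (chainEquiv X (k + 1) (simplexChain σ))
    rw [d_simplexChain, chainEquiv_simplexChain, bdry_single, map_sum]
    refine Finset.sum_congr rfl fun i _ => ?_
    rw [← chainEquiv_simplexChain]
    exact map_zsmul (chainEquiv X k) _ _
  exact congrArg (fun f => f.hom c) this

theorem bdry_bdry {k : ℕ} (c : Ch X (k + 2)) : bdry X k (bdry X (k + 1) c) = 0 := by
  obtain ⟨c, rfl⟩ := (chainEquiv X (k + 2)).surjective c
  rw [← chainEquiv_d, ← chainEquiv_d]
  have h := congrArg (fun f => f.hom c) ((singularChains X).d_comp_d (k + 2) (k + 1) k)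
  exact (congrArg (chainEquiv X k) h).trans (map_zero _)

theorem chainEquiv_map {Y : Type u} [TopologicalSpace Y] (f : C(X, Y)) {k : ℕ}
    (c : (singularChains X).X k) :
    chainEquiv Y k (((((singularChainComplexFunctor (ModuleCat.{u} ℤ)).obj
      (ModuleCat.of ℤ (ULift.{u} ℤ))).map (TopCat.ofHom f)).f k).hom c) =
      chMap f k (chainEquiv X k c) := by
  have : ((((singularChainComplexFunctor (ModuleCat.{u} ℤ)).obj
      (ModuleCat.of ℤ (ULift.{u} ℤ))).map (TopCat.ofHom f)).f k) ≫ chainCoeff Y k =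
      chainCoeff X k ≫ ModuleCat.ofHom (chMap f k) := by
    refine chain_hom_ext fun σ => ?_
    change chainEquiv Y k (((((singularChainComplexFunctor (ModuleCat.{u} ℤ)).obj
      (ModuleCat.of ℤ (ULift.{u} ℤ))).map (TopCat.ofHom f)).f k).hom (simplexChain σ)) =
      chMap f k (chainEquiv X k (simplexChain σ))
    rw [chainEquiv_simplexChain, chMap_single, ← chainEquiv_simplexChain]
    have h := congrArg (fun g => g.hom ⟨1⟩) (SSet.ι_chainComplexMap_f _ _
      (TopCat.toSSet.map (TopCat.ofHom f)) (ModuleCat.of ℤ (ULift.{u} ℤ))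
      ((simplexEquiv X k).symm σ))
    exact congrArg (chainEquiv Y k) h
  exact congrArg (fun f => f.hom c) this

end Chains

/-! ### Cycles and homology classes -/

section Homology

variable {X : Type u} [TopologicalSpace X]

/-- The chain underlying a cycle. -/
def cycleChain (z : (singularChains X).cycles 1) : Ch X 1 :=
  chainEquiv X 1 (((singularChains X).iCycles 1).hom z)

theorem bdry_cycleChain (z : (singularChains X).cycles 1) : bdry X 0 (cycleChain z) = 0 := by
  rw [cycleChain, ← chainEquiv_d]
  have h := congrArg (fun f => f.hom z) ((singularChains X).iCycles_d 1 0)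
  exact (congrArg (chainEquiv X 0) h).trans (map_zero _)

theorem exists_cycleChain_eq (c : Ch X 1) (hc : bdry X 0 c = 0) :
    ∃ z : (singularChains X).cycles 1, cycleChain z = c := by
  obtain ⟨c, rfl⟩ := (chainEquiv X 1).surjective c
  rw [← chainEquiv_d, map_eq_zero_iff _ (chainEquiv X 0).injective] at hc
  exact ⟨(singularChains X).cyclesMk (i := 1) c 0 (by simp) hc,
    congrArg (chainEquiv X 1) ((singularChains X).i_cyclesMk (i := 1) c 0 (by simp) hc)⟩

theorem homologyπ_surjective (X : Type u) [TopologicalSpace X] :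
    Function.Surjective ((singularChains X).homologyπ 1).hom :=
  (ModuleCat.epi_iff_surjective _).1 inferInstance

theorem cycleChain_injective (X : Type u) [TopologicalSpace X] :
    Function.Injective (cycleChain (X := X)) :=
  (chainEquiv X 1).injective.comp
    ((ModuleCat.mono_iff_injective ((singularChains X).iCycles 1)).1 inferInstance)

/-- Homology is the cokernel of `toCycles`, and `toCycles` followed by the inclusion of cycles is
the boundary. -/
theorem homologyπ_eq_zero_iff (z : (singularChains X).cycles 1) :
    ((singularChains X).homologyπ 1).hom z = 0 ↔ ∃ w, bdry X 1 w = cycleChain z := by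
  have hex : (ShortComplex.mk _ _ ((singularChains X).toCycles_comp_homologyπ 2 1)).Exact :=
    ShortComplex.exact_of_g_is_cokernel _
      ((singularChains X).homologyIsCokernel 2 1 (by simp))
  rw [ShortComplex.moduleCat_exact_iff] at hex
  have hi : ∀ w, cycleChain (((singularChains X).toCycles 2 1).hom w) =
      bdry X 1 (chainEquiv X 2 w) := fun w => by
    rw [← chainEquiv_d]
    exact congrArg (fun f => chainEquiv X 1 (f.hom w)) ((singularChains X).toCycles_i 2 1)
  constructor
  · intro h
    obtain ⟨w, hw⟩ := hex z h
    exact ⟨chainEquiv X 2 w, by rw [← hi]; exact congrArg _ hw⟩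
  · rintro ⟨w, hw⟩
    obtain ⟨w, rfl⟩ := (chainEquiv X 2).surjective w
    rw [← hi] at hw
    rw [← cycleChain_injective X hw]
    exact congrArg (fun f => f.hom w) ((singularChains X).toCycles_comp_homologyπ 2 1)

/-- Since cycles embed in chains, it is enough to compare the underlying chains. -/
theorem H₁.map_homologyπ {Y : Type u} [TopologicalSpace Y] (f : C(X, Y))
    (z : (singularChains X).cycles 1) (z' : (singularChains Y).cycles 1)
    (h : chMap f 1 (cycleChain z) = cycleChain z') :
    H₁.map f (((singularChains X).homologyπ 1).hom z) =
      ((singularChains Y).homologyπ 1).hom z' := by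
  let F := ((singularChainComplexFunctor (ModuleCat.{u} ℤ)).obj
      (ModuleCat.of ℤ (ULift.{u} ℤ))).map (TopCat.ofHom f)
  have h1 := congrArg (fun g => g.hom z) (HomologicalComplex.homologyπ_naturality F 1)
  have h2 := congrArg (fun g => chainEquiv Y 1 (g.hom z)) (HomologicalComplex.cyclesMap_i F 1)
  have h3 : (HomologicalComplex.cyclesMap F 1).hom z = z' := by
    apply cycleChain_injective
    rw [← h]
    exact Eq.trans h2 (chainEquiv_map f _)
  rw [← h3]
  exact h1

end Homology

/-! ### Homology of contractible spaces -/

/-- The identity is homotopic to a map through a point, so the identity of `H₁` factors through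
zero. -/
theorem subsingleton_H₁_of_contractible (X : Type u) [TopologicalSpace X] [ContractibleSpace X] :
    Subsingleton (H₁ X) := by
  obtain ⟨y, ⟨h⟩⟩ := id_nullhomotopic X
  let F := (singularHomologyFunctor (ModuleCat.{u} ℤ) 1).obj (ModuleCat.of ℤ (ULift.{u} ℤ))
  have h0 : Limits.IsZero (F.obj (TopCat.of PUnit.{u + 1})) :=
    isZero_singularHomologyFunctor_of_totallyDisconnectedSpace _ 1 _ _ one_ne_zero
  let H : TopCat.Homotopy (𝟙 (TopCat.of X))
      (TopCat.ofHom (ContinuousMap.const X PUnit.unit.{u + 1}) ≫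
        TopCat.ofHom (ContinuousMap.const PUnit y)) := h
  have h1 : F.map (𝟙 (TopCat.of X)) = F.map _ :=
    H.congr_homologyMap_singularChainComplexFunctor (ModuleCat.of ℤ (ULift.{u} ℤ)) 1
  rw [F.map_id, F.map_comp, h0.eq_of_src (F.map (TopCat.ofHom (ContinuousMap.const PUnit y))) 0,
    Limits.comp_zero] at h1
  exact ModuleCat.subsingleton_of_isZero ((Limits.IsZero.iff_id_eq_zero (F.obj (TopCat.of X))).2 h1)

/-! ### Paths as singular simplices -/

section Paths

variable {X : Type u} [TopologicalSpace X]

/-- The initial point of a singular `1`-simplex. -/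
def src (σ : C(Simp 1, X)) : X := σ (stdSimplex.vertex 0)

/-- The terminal point of a singular `1`-simplex. -/
def tgt (σ : C(Simp 1, X)) : X := σ (stdSimplex.vertex 1)

/-- A point, as a singular `0`-chain. -/
def pt (x : X) : Ch X 0 := Finsupp.single (ContinuousMap.const _ x) 1

theorem bdry_zero_single (σ : C(Simp 1, X)) :
    bdry X 0 (Finsupp.single σ 1) = pt (tgt σ) - pt (src σ) := by
  have h : ∀ i : Fin 2, σ.comp (face i) =
      ContinuousMap.const _ (σ (stdSimplex.vertex (i.succAbove 0))) := fun i => by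
    ext t
    have ht : t = stdSimplex.vertex 0 := Subsingleton.elim _ _
    subst ht
    simp only [ContinuousMap.comp_apply, ContinuousMap.const_apply, face, ContinuousMap.coe_mk,
      stdSimplex.map_vertex]
  rw [bdry_single, Fin.sum_univ_two, h, h]
  simp [pt, src, tgt, sub_eq_add_neg]

/-- The affine singular simplex with given vertices, followed by a continuous map. -/
def affineSimplex (f : C(ℝ, X)) {k : ℕ} (a : Fin (k + 1) → ℝ) :
    C(Simp k, X) :=
  f.comp ⟨fun t => ∑ i, t.1 i * a i, continuous_finsetSum _ fun i _ =>
    ((continuous_apply i).comp continuous_subtype_val).mul continuous_const⟩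

theorem affineSimplex_comp_face (f : C(ℝ, X)) {k : ℕ} (a : Fin (k + 2) → ℝ)
    (i : Fin (k + 2)) :
    (affineSimplex f a).comp (face i) = affineSimplex f (a ∘ i.succAbove) := by
  ext t
  refine congrArg f ?_
  change ∑ j, (stdSimplex.map i.succAbove t) j * a j = ∑ j, t j * a (i.succAbove j)
  simp only [stdSimplex.map_coe, FunOnFinite.linearMap_apply_apply, Finset.sum_mul]
  rw [← Finset.sum_fiberwise Finset.univ i.succAbove]
  refine Finset.sum_congr rfl fun j _ => Finset.sum_congr rfl fun l hl => ?_
  rw [(Finset.mem_filter.1 hl).2]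

/-- The chains having a nonzero multiple which is a boundary. -/
def weakBoundaries (X : Type u) [TopologicalSpace X] : Submodule ℤ (Ch X 1) :=
  (Submodule.torsion ℤ (Ch X 1 ⧸ LinearMap.range (bdry X 1))).comap
    (LinearMap.range (bdry X 1)).mkQ

theorem mem_weakBoundaries {c : Ch X 1} :
    c ∈ weakBoundaries X ↔ ∃ n : ℤ, n ≠ 0 ∧ ∃ w, bdry X 1 w = n • c := by
  rw [weakBoundaries, Submodule.mem_comap, Submodule.mem_torsion_iff]
  constructor
  · rintro ⟨n, hn⟩
    refine ⟨n, nonZeroDivisors.coe_ne_zero n, ?_⟩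
    have : (LinearMap.range (bdry X 1)).mkQ ((n : ℤ) • c) = 0 := by rw [map_smul]; exact hn
    rwa [Submodule.mkQ_apply, Submodule.Quotient.mk_eq_zero] at this
  · rintro ⟨n, hn, hw⟩
    refine ⟨⟨n, mem_nonZeroDivisors_of_ne_zero hn⟩, ?_⟩
    have : (LinearMap.range (bdry X 1)).mkQ (n • c) = 0 := by
      rwa [Submodule.mkQ_apply, Submodule.Quotient.mk_eq_zero]
    rw [map_smul] at this
    exact this

/-- Chains modulo weak boundaries. -/
abbrev ReducedChains (X : Type u) [TopologicalSpace X] : Type u := Ch X 1 ⧸ weakBoundaries X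

/-- The class of a path. -/
def pathClass (σ : C(Simp 1, X)) : ReducedChains X :=
  (weakBoundaries X).mkQ (Finsupp.single σ 1)

theorem mkQ_bdry (w : Ch X 2) : (weakBoundaries X).mkQ (bdry X 1 w) = 0 := by
  rw [Submodule.mkQ_apply, Submodule.Quotient.mk_eq_zero, mem_weakBoundaries]
  exact ⟨1, one_ne_zero, w, by simp⟩

/-- The relation is the boundary of the triangle with vertices `a, b, c`, collapsed onto the line
and mapped by `f`; no order of the three numbers is needed. -/
theorem pathClass_affineSimplex_add (f : C(ℝ, X)) (a b c : ℝ) :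
    pathClass (affineSimplex f ![a, b]) + pathClass (affineSimplex f ![b, c]) =
      pathClass (affineSimplex f ![a, c]) := by
  have h := mkQ_bdry (Finsupp.single (affineSimplex f ![a, b, c]) 1)
  rw [bdry_single, Fin.sum_univ_three] at h
  simp only [affineSimplex_comp_face] at h
  have e0 : ![a, b, c] ∘ (0 : Fin 3).succAbove = ![b, c] := by ext i; fin_cases i <;> rfl
  have e1 : ![a, b, c] ∘ (1 : Fin 3).succAbove = ![a, c] := by ext i; fin_cases i <;> rfl
  have e2 : ![a, b, c] ∘ (2 : Fin 3).succAbove = ![a, b] := by ext i; fin_cases i <;> rfl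
  rw [e0, e1, e2] at h
  simp only [Fin.val_zero, pow_zero, one_smul, Fin.val_one, pow_one, neg_smul, Fin.val_two,
    map_add, map_neg, even_two, Even.neg_pow, one_pow] at h
  change pathClass _ + -pathClass _ + pathClass _ = 0 at h
  rw [← sub_eq_zero, ← h]
  abel

theorem pathClass_affineSimplex_self (f : C(ℝ, X)) (a : ℝ) :
    pathClass (affineSimplex f ![a, a]) = 0 :=
  add_eq_left.1 (pathClass_affineSimplex_add f a a a)

theorem src_affineSimplex (f : C(ℝ, X)) (a b : ℝ) : src (affineSimplex f ![a, b]) = f a := by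
  simp [src, affineSimplex]

theorem tgt_affineSimplex (f : C(ℝ, X)) (a b : ℝ) : tgt (affineSimplex f ![a, b]) = f b := by
  simp [tgt, affineSimplex]

theorem range_affineSimplex_subset (f : C(ℝ, X)) {a b : ℝ} (h : a ≤ b) :
    Set.range (affineSimplex f ![a, b]) ⊆ f '' Set.Icc a b := by
  rintro _ ⟨t, rfl⟩
  have h0 := t.2.1 0
  have h1 := t.2.1 1
  have h2 : t.1 0 = 1 - t.1 1 := eq_sub_of_add_eq ((Fin.sum_univ_two _).symm.trans t.2.2)
  have e : ∑ i, t.1 i * ![a, b] i = t.1 0 * a + t.1 1 * b := Fin.sum_univ_two _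
  refine ⟨t.1 0 * a + t.1 1 * b, ?_, (congrArg f e).symm⟩
  rw [h2] at h0 ⊢
  constructor <;> nlinarith

/-- The singular simplex of a path. -/
def pathSimplex {x y : X} (γ : Path x y) : C(Simp 1, X) :=
  affineSimplex ⟨γ.extend, γ.continuous_extend⟩ ![0, 1]

theorem src_pathSimplex {x y : X} (γ : Path x y) : src (pathSimplex γ) = x := by
  simp [pathSimplex, src_affineSimplex]

theorem tgt_pathSimplex {x y : X} (γ : Path x y) : tgt (pathSimplex γ) = y := by
  simp [pathSimplex, tgt_affineSimplex]

theorem range_pathSimplex_subset {x y : X} (γ : Path x y) :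
    Set.range (pathSimplex γ) ⊆ Set.range γ := by
  refine (range_affineSimplex_subset _ zero_le_one).trans ?_
  rintro _ ⟨t, -, rfl⟩
  rw [← γ.extend_range]
  exact ⟨t, rfl⟩

/-- The path of a singular `1`-simplex. -/
def simplexPath (σ : C(Simp 1, X)) : Path (src σ) (tgt σ) where
  toFun := σ ∘ stdSimplexHomeomorphUnitInterval.symm
  continuous_toFun := by fun_prop
  source' := congrArg σ (stdSimplexHomeomorphUnitInterval.symm_apply_eq.2
    stdSimplexHomeomorphUnitInterval_zero.symm)
  target' := congrArg σ (stdSimplexHomeomorphUnitInterval.symm_apply_eq.2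
    stdSimplexHomeomorphUnitInterval_one.symm)

theorem pathSimplex_simplexPath (σ : C(Simp 1, X)) : pathSimplex (simplexPath σ) = σ := by
  ext t
  have h0 := t.2.1 0
  have h1 := t.2.1 1
  have h2 : t.1 0 + t.1 1 = 1 := (Fin.sum_univ_two _).symm.trans t.2.2
  have ht : t.1 1 ∈ Set.Icc (0 : ℝ) 1 := ⟨h1, by linarith⟩
  change (simplexPath σ).extend (∑ i, t.1 i * ![(0 : ℝ), 1] i) = σ t
  have : ∑ i, t.1 i * ![(0 : ℝ), 1] i = t.1 1 := by simp
  rw [this, Path.extend_apply _ ht]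
  refine congrArg σ (stdSimplexHomeomorphUnitInterval.symm_apply_eq.2 (Subtype.ext ?_))
  rfl

theorem range_simplexPath (σ : C(Simp 1, X)) : Set.range (simplexPath σ) = Set.range σ :=
  stdSimplexHomeomorphUnitInterval.symm.surjective.range_comp σ

end Paths

/-! ### Torsion classes and weak boundaries -/

theorem cycleChain_zsmul {X : Type u} [TopologicalSpace X] (n : ℤ)
    (z : (singularChains X).cycles 1) : cycleChain (n • z) = n • cycleChain z :=
  (congrArg (chainEquiv X 1) (map_zsmul ((singularChains X).iCycles 1).hom n z)).trans
    (map_zsmul (chainEquiv X 1) n _)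

theorem homologyπ_mem_torsion_iff {X : Type u} [TopologicalSpace X]
    (z : (singularChains X).cycles 1) :
    ((singularChains X).homologyπ 1).hom z ∈ Submodule.torsion ℤ (H₁ X) ↔
      cycleChain z ∈ weakBoundaries X := by
  rw [mem_weakBoundaries, Submodule.mem_torsion_iff]
  have h : ∀ n : ℤ, n • ((singularChains X).homologyπ 1).hom z = 0 ↔
      ∃ w, bdry X 1 w = n • cycleChain z := fun n => by
    rw [← cycleChain_zsmul, ← homologyπ_eq_zero_iff]
    exact Eq.congr_left (map_zsmul ((singularChains X).homologyπ 1).hom n z).symm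
  constructor
  · rintro ⟨n, hn⟩
    exact ⟨n, nonZeroDivisors.coe_ne_zero n, (h n).1 (by
      -- Passes between the `ℤ`-action of the module object and the one of its additive group.
      rw [← int_smul_eq_zsmul ((singularChains X).homology 1).isModule]
      exact hn)⟩
  · rintro ⟨n, hn, hw⟩
    refine ⟨⟨n, mem_nonZeroDivisors_of_ne_zero hn⟩, ?_⟩
    rw [← h n, ← int_smul_eq_zsmul ((singularChains X).homology 1).isModule] at hw
    exact hw

/-! ### Potentials -/

section Potentials

variable {X : Type u} [TopologicalSpace X]

/-- To control the class of a path up to endpoint terms, it suffices to do so for paths that are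
small with respect to an open cover of a neighbourhood of the path. -/
theorem pathClass_sub_mem_of_cover {ι : Type*} {U : ι → Set X} (hU : ∀ i, IsOpen (U i))
    (F : Submodule ℤ (ReducedChains X)) (s : X → ReducedChains X)
    (h : ∀ i (σ : C(Simp 1, X)), Set.range σ ⊆ U i → pathClass σ - (s (tgt σ) - s (src σ)) ∈ F)
    (σ : C(Simp 1, X)) (hσ : Set.range σ ⊆ ⋃ i, U i) :
    pathClass σ - (s (tgt σ) - s (src σ)) ∈ F := by
  let γ := simplexPath σ
  let f : C(ℝ, X) := ⟨γ.extend, γ.continuous_extend⟩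
  -- Lebesgue subdivision: each interval `[t n, t (n + 1)]` is mapped into one `U i`, and `t` equals
  -- `1` from `N` on.
  obtain ⟨t, ht0, htm, ⟨N, hN⟩, ht⟩ := exists_monotone_Icc_subset_open_cover_unitInterval
    (c := fun i => γ ⁻¹' U i) (fun i => (hU i).preimage γ.continuous) (by
      intro x _
      have := hσ (range_simplexPath σ ▸ Set.mem_range_self x)
      simpa using this)
  -- Concatenation adds path classes, and the endpoint terms telescope.
  have key : ∀ n, pathClass (affineSimplex f ![0, t n]) - (s (f (t n)) - s (f 0)) ∈ F := by
    intro n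
    induction n with
    | zero => simp [ht0, pathClass_affineSimplex_self]
    | succ n ih =>
      obtain ⟨i, hi⟩ := ht n
      have hle : (t n : ℝ) ≤ t (n + 1) := htm n.le_succ
      have h1 := h i (affineSimplex f ![(t n : ℝ), t (n + 1)]) (by
        refine (range_affineSimplex_subset f hle).trans ?_
        rintro _ ⟨x, hx, rfl⟩
        have hx' : x ∈ Set.Icc (0 : ℝ) 1 :=
          ⟨(t n).2.1.trans hx.1, hx.2.trans (t (n + 1)).2.2⟩
        have := hi (show (⟨x, hx'⟩ : unitInterval) ∈ Set.Icc (t n) (t (n + 1)) from hx)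
        change γ.extend x ∈ U i
        rw [Path.extend_apply _ hx']
        exact this)
      rw [src_affineSimplex, tgt_affineSimplex] at h1
      rw [← pathClass_affineSimplex_add f 0 (t n) (t (n + 1))]
      have h2 := F.add_mem ih h1
      convert! h2 using 1
      abel
  have h1 := key N
  rw [hN N le_rfl] at h1
  have h2 : affineSimplex f ![0, ((1 : unitInterval) : ℝ)] = σ := pathSimplex_simplexPath σ
  have h3 : f ((1 : unitInterval) : ℝ) = tgt σ := by simp [f]
  have h4 : f 0 = src σ := by simp [f]
  rwa [h2, h3, h4] at h1

/-- The function `s` computes the classes of all paths in `U`. -/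
def IsPotential (U : Set X) (s : X → ReducedChains X) : Prop :=
  ∀ σ : C(Simp 1, X), Set.range σ ⊆ U → pathClass σ = s (tgt σ) - s (src σ)

theorem IsPotential.mono {U V : Set X} {s : X → ReducedChains X} (h : IsPotential V s)
    (hUV : U ⊆ V) : IsPotential U s := fun σ hσ => h σ (hσ.trans hUV)

theorem IsPotential.iUnion {ι : Type*} {U : ι → Set X} (hU : ∀ i, IsOpen (U i))
    {s : X → ReducedChains X} (h : ∀ i, IsPotential (U i) s) : IsPotential (⋃ i, U i) s := by
  intro σ hσ
  -- With `F = ⊥` the error term vanishes.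
  have := pathClass_sub_mem_of_cover hU ⊥ s (fun i σ hσ => by rw [h i σ hσ]; simp) σ hσ
  rwa [Submodule.mem_bot, sub_eq_zero] at this

theorem src_mem {σ : C(Simp 1, X)} {U : Set X} (h : Set.range σ ⊆ U) : src σ ∈ U := h ⟨_, rfl⟩

theorem tgt_mem {σ : C(Simp 1, X)} {U : Set X} (h : Set.range σ ⊆ U) : tgt σ ∈ U := h ⟨_, rfl⟩

theorem IsPotential.congr_add {U : Set X} {s s' : X → ReducedChains X} (h : IsPotential U s)
    (c : ReducedChains X) (hs : ∀ x ∈ U, s' x = s x + c) : IsPotential U s' := by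
  intro σ hσ
  rw [hs _ (src_mem hσ), hs _ (tgt_mem hσ), h σ hσ]
  abel

/-- Both potentials have the same increment along a path from `x` to `y`, namely its class. -/
theorem IsPotential.sub_eq_of_joinedIn {U : Set X} {s s' : X → ReducedChains X}
    (h : IsPotential U s) (h' : IsPotential U s') {x y : X} (hxy : JoinedIn U x y) :
    s x - s' x = s y - s' y := by
  obtain ⟨γ, hγ⟩ := hxy
  have hr : Set.range (pathSimplex γ) ⊆ U :=
    (range_pathSimplex_subset γ).trans (Set.range_subset_iff.2 hγ)
  have h1 := (h _ hr).symm.trans (h' _ hr)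
  rw [src_pathSimplex, tgt_pathSimplex] at h1
  have : s x - s' x = s y - s' y - ((s y - s x) - (s' y - s' x)) := by abel
  rw [this, h1]
  abel

/-- In a subspace whose first homology is torsion, the class of a path depends only on its
endpoints, up to torsion. -/
theorem exists_isPotential_range {W : Type v} [TopologicalSpace W] [PathConnectedSpace W]
    (hW : Module.IsTorsion ℤ (H₁ W)) {φ : C(W, X)} (hφ : Topology.IsEmbedding φ) :
    ∃ s, IsPotential (Set.range φ) s := by
  let p : W := Classical.arbitrary W
  let γ : ∀ x, C(Simp 1, W) := fun x => pathSimplex (PathConnectedSpace.somePath p x)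
  -- The potential at `φ x` is the class of a chosen path from the base point to `x`; the value `0`
  -- off the range plays no role.
  refine ⟨Function.extend φ (fun x => pathClass (φ.comp (γ x))) 0, fun σ hσ => ?_⟩
  obtain ⟨c, hc⟩ := exists_chMap_eq hφ (Finsupp.single σ 1) (k := 1) (fun σ' hσ' => by
    have := Finsupp.support_single_subset hσ'
    rw [Finset.mem_singleton] at this
    rwa [this])
  obtain ⟨x, hx⟩ := src_mem hσ
  obtain ⟨y, hy⟩ := tgt_mem hσ
  rw [← hx, ← hy, hφ.injective.extend_apply, hφ.injective.extend_apply]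
  have hb : bdry W 0 c = pt y - pt x := by
    apply chMap_injective hφ.injective 0
    rw [← bdry_chMap, hc, bdry_zero_single, ← hx, ← hy, map_sub]
    simp only [pt, chMap_single]
    rfl
  -- The lift of `σ`, closed up by the chosen paths from the base point to its two ends.
  let z : Ch W 1 := c + Finsupp.single (γ x) 1 - Finsupp.single (γ y) 1
  have hz : bdry W 0 z = 0 := by
    rw [map_sub, map_add, hb, bdry_zero_single, bdry_zero_single, src_pathSimplex,
      src_pathSimplex, tgt_pathSimplex, tgt_pathSimplex]
    abel
  obtain ⟨z', hz'⟩ := exists_cycleChain_eq z hz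
  have hw := (homologyπ_mem_torsion_iff z').1 (Submodule.mem_torsion_iff _ |>.2 (@hW _))
  rw [hz', mem_weakBoundaries] at hw
  obtain ⟨n, hn, w, hw⟩ := hw
  -- A bounding chain for a multiple of `z` in `W` is pushed forward to `X`.
  have h0 : chMap φ 1 z ∈ weakBoundaries X :=
    mem_weakBoundaries.2 ⟨n, hn, chMap φ 2 w, by rw [bdry_chMap, hw, map_smul]⟩
  rw [← Submodule.Quotient.mk_eq_zero, ← Submodule.mkQ_apply, map_sub, map_sub, map_add, map_add,
    hc, chMap_single, chMap_single] at h0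
  change pathClass σ + pathClass (φ.comp (γ x)) - pathClass (φ.comp (γ y)) = 0 at h0
  rw [← sub_eq_zero, ← h0]
  abel
end Potentials

/-! ### Gluing potentials -/

section Gluing

variable {X : Type u} [TopologicalSpace X]

/-- Potentials on a sequence of open sets such that only consecutive ones meet, in path connected
sets, can be adjusted so as to agree. -/
theorem exists_isPotential_iUnion_nat {U : ℕ → Set X} (hU : ∀ k, IsOpen (U k))
    (hpot : ∀ k, ∃ s, IsPotential (U k) s) (hconn : ∀ k, IsPathConnected (U k ∩ U (k + 1)))
    (hdisj : ∀ k l, k + 2 ≤ l → Disjoint (U k) (U l)) : ∃ s, IsPotential (⋃ k, U k) s := by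
  classical
  choose s hs using hpot
  choose q hq hq' using hconn
  -- The constants accumulate the jumps at the points `q k`, so that `s k + c k` and `s (k + 1) + c
  -- (k + 1)` agree at `q k`, hence on the whole path connected overlap.
  let c : ℕ → ReducedChains X := fun k =>
    Nat.rec 0 (fun k ck => ck + (s k (q k) - s (k + 1) (q k))) k
  have hc : ∀ k x, x ∈ U k → x ∈ U (k + 1) → s k x + c k = s (k + 1) x + c (k + 1) := by
    intro k x hx hx'
    have h := ((hs k).mono Set.inter_subset_left).sub_eq_of_joinedIn
      ((hs (k + 1)).mono Set.inter_subset_right) (hq' k ⟨hx, hx'⟩)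
    change _ = s (k + 1) x + (c k + (s k (q k) - s (k + 1) (q k)))
    rw [h]
    abel
  have hc' : ∀ k l x, x ∈ U k → x ∈ U l → k ≤ l → s k x + c k = s l x + c l := by
    intro k l x hk hl hkl
    rcases Nat.lt_or_ge l (k + 2) with h | h
    · obtain rfl | rfl : l = k ∨ l = k + 1 := by omega
      · rfl
      · exact hc k x hk hl
    · exact ((hdisj k l h).le_bot ⟨hk, hl⟩).elim
  -- By `hc'` the value does not depend on the index chosen.
  let t : X → ReducedChains X := fun x =>
    if h : ∃ k, x ∈ U k then s h.choose x + c h.choose else 0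
  refine ⟨t, IsPotential.iUnion hU fun k => (hs k).congr_add (c k) fun x hx => ?_⟩
  have h : ∃ k, x ∈ U k := ⟨k, hx⟩
  simp only [t, dif_pos h]
  rcases le_total h.choose k with hle | hle
  · exact hc' _ _ x h.choose_spec hx hle
  · exact (hc' _ _ x hx h.choose_spec hle).symm

/-- If finitely many potentials on an open cover differ from each other by finitely many values
only, then the cycles modulo weak boundaries lie in a finitely generated group. -/
theorem exists_fg_of_cover {ι : Type*} [Finite ι] {U : ι → Set X} (hU : ∀ i, IsOpen (U i))
    (hcover : ⋃ i, U i = Set.univ) {s : ι → X → ReducedChains X}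
    (hs : ∀ i, IsPotential (U i) (s i))
    (hfin : ∀ i j, ((fun x => s i x - s j x) '' (U i ∩ U j)).Finite) :
    ∃ F : Submodule ℤ (ReducedChains X), F.FG ∧
      ∀ z, bdry X 0 z = 0 → (weakBoundaries X).mkQ z ∈ F := by
  have hcov : ∀ x, ∃ i, x ∈ U i := fun x => by
    simpa using (hcover ▸ Set.mem_univ x : x ∈ ⋃ i, U i)
  choose i hi using hcov
  let D : Set (ReducedChains X) := ⋃ j, ⋃ k, (fun x => s j x - s k x) '' (U j ∩ U k)
  have hD : D.Finite := Set.finite_iUnion fun j => Set.finite_iUnion fun k => hfin j k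
  let t : X → ReducedChains X := fun x => s (i x) x
  have hmem : ∀ j x, x ∈ U j → s j x - t x ∈ Submodule.span ℤ D := fun j x hx =>
    Submodule.subset_span (Set.mem_iUnion₂.2 ⟨j, i x, x, ⟨hx, hi x⟩, rfl⟩)
  have hpath : ∀ σ : C(Simp 1, X), pathClass σ - (t (tgt σ) - t (src σ)) ∈ Submodule.span ℤ D :=
    fun σ => pathClass_sub_mem_of_cover hU _ t (fun j σ hσ => by
      have h := Submodule.sub_mem _ (hmem j _ (tgt_mem hσ)) (hmem j _ (src_mem hσ))
      rw [hs j σ hσ]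
      convert! h using 1
      abel) σ (by rw [hcover]; exact Set.subset_univ _)
  -- The linear extension of `t` to 0-chains. Modulo the span of `D`, the class of any chain is `S`
  -- of its boundary, which is zero for a cycle.
  let S : Ch X 0 →ₗ[ℤ] ReducedChains X := Finsupp.linearCombination ℤ fun p => t (p default)
  have hS : ∀ x, S (pt x) = t x := fun x => by simp [S, pt]
  refine ⟨Submodule.span ℤ D, Submodule.fg_span hD, fun z hz => ?_⟩
  have hR : ∀ c, ((weakBoundaries X).mkQ - S ∘ₗ bdry X 0) c ∈ Submodule.span ℤ D := by
    intro c
    induction c using Finsupp.induction_linear with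
    | zero => simp
    | add c d hc hd => rw [map_add]; exact Submodule.add_mem _ hc hd
    | single σ n =>
      rw [← mul_one n, ← smul_eq_mul, ← Finsupp.smul_single, map_smul]
      refine Submodule.smul_mem _ _ ?_
      rw [LinearMap.sub_apply, LinearMap.comp_apply, bdry_zero_single, map_sub, hS, hS]
      exact hpath σ
  have := hR z
  rwa [LinearMap.sub_apply, LinearMap.comp_apply, hz, map_zero, sub_zero] at this

/-- The difference is constant on path components of `O`, which are neighbourhoods of their points;
finitely many cover `L`. -/
theorem finite_image_sub_of_isCompact [LocallyPathConnectedSpace X] {O : Set X} (hO : IsOpen O)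
    {s s' : X → ReducedChains X} (h : IsPotential O s) (h' : IsPotential O s') {L : Set X}
    (hL : IsCompact L) (hLO : L ⊆ O) : ((fun x => s x - s' x) '' L).Finite := by
  refine hL.induction_on (p := fun A => ((fun x => s x - s' x) '' A).Finite) (by simp)
    (fun A B hAB hB => hB.subset (Set.image_mono hAB))
    (fun A B hA hB => by rw [Set.image_union]; exact hA.union hB) fun x hx => ?_
  refine ⟨pathComponentIn O x, mem_nhdsWithin_of_mem_nhds
    (pathComponentIn_mem_nhds (hO.mem_nhds (hLO hx))), ?_⟩
  refine (Set.finite_singleton (s x - s' x)).subset ?_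
  rintro _ ⟨y, hy, rfl⟩
  exact (h.sub_eq_of_joinedIn h' hy).symm

/-- If `X` is covered by a compact set and finitely many disjoint open sets with potentials, then
the cycles modulo weak boundaries lie in a finitely generated group. -/
theorem exists_fg_of_isCompact [T2Space X] [LocallyCompactSpace X] [LocallyPathConnectedSpace X]
    (hloc : ∀ x : X, ∃ U, IsOpen U ∧ x ∈ U ∧ ∃ s, IsPotential U s)
    {E : Type*} [Finite E] {Z : Set X} (hZ : IsCompact Z) {M : E → Set X}
    (hM : ∀ e, IsOpen (M e)) (hdisj : ∀ e e', e ≠ e' → Disjoint (M e) (M e'))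
    (hcover : Z ∪ ⋃ e, M e = Set.univ) (hpot : ∀ e, ∃ s, IsPotential (M e) s) :
    ∃ F : Submodule ℤ (ReducedChains X), F.FG ∧
      ∀ z, bdry X 0 z = 0 → (weakBoundaries X).mkQ z ∈ F := by
  choose U hUo hxU s hs using hloc
  choose t ht using hpot
  -- Nested compact neighbourhoods `B x ⊆ interior (A x)` and `A x ⊆ U x`: the interiors of finitely
  -- many `B x` cover `Z`, and the larger sets leave room for shrinking.
  choose A hAc hxA hAU using fun x => exists_compact_subset (hUo x) (hxU x)
  choose B hBc hxB hBA using fun x => exists_compact_subset isOpen_interior (hxA x)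
  obtain ⟨T, -, hT⟩ := hZ.elim_nhds_subcover (fun x => interior (B x)) fun x _ =>
    isOpen_interior.mem_nhds (hxB x)
  -- `interior (A x) ∩ M e` may accumulate at the frontier of `M e`, where compactness gives no
  -- control. Removing the sets `B x` from `M e` keeps away from that frontier.
  let V : T ⊕ E → Set X := Sum.elim (fun x => interior (A x)) fun e => M e \ ⋃ x ∈ T, B x
  have hBcl : IsClosed (⋃ x ∈ T, B x) :=
    T.finite_toSet.isClosed_biUnion fun x _ => (hBc x).isClosed
  refine exists_fg_of_cover (U := V) (s := Sum.elim (fun x => s x) t) ?_ ?_ ?_ ?_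
  · rintro (x | e)
    · exact isOpen_interior
    · exact (hM e).sdiff hBcl
  · refine Set.eq_univ_of_forall fun y => ?_
    by_cases hy : y ∈ ⋃ x ∈ T, B x
    · obtain ⟨x, hx, hyx⟩ := Set.mem_iUnion₂.1 hy
      exact Set.mem_iUnion.2 ⟨Sum.inl ⟨x, hx⟩, hBA x hyx⟩
    · have hyZ : y ∉ Z := fun h => hy (Set.iUnion₂_mono (fun x _ => interior_subset) (hT h))
      obtain h | h := (hcover ▸ Set.mem_univ y : y ∈ Z ∪ ⋃ e, M e)
      · exact (hyZ h).elim
      · obtain ⟨e, he⟩ := Set.mem_iUnion.1 h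
        exact Set.mem_iUnion.2 ⟨Sum.inr e, he, hy⟩
  · rintro (x | e)
    · exact (hs x).mono (interior_subset.trans (hAU x))
    · exact (ht e).mono Set.sdiff_subset
  · have hmixed : ∀ (x : T) (e : E),
        ((fun y => s x y - t e y) '' (interior (A x) ∩ (M e \ ⋃ x ∈ T, B x))).Finite := by
      intro x e
      -- A point outside `O` is neither in `Z` nor in another end, so it lies in `M e`. Thus `A x \
      -- O` is a compact subset of `U x ∩ M e`, and it contains the overlap in question.
      let O : Set X := (⋃ x ∈ T, interior (B x)) ∪ ⋃ e' ∈ {e' | e' ≠ e}, M e'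
      have hO : IsOpen O := (isOpen_biUnion fun x _ => isOpen_interior).union
        (isOpen_biUnion fun e' _ => hM e')
      have hsub : A x \ O ⊆ U x ∩ M e := by
        rintro y ⟨hyA, hyO⟩
        refine ⟨hAU x hyA, ?_⟩
        obtain h | h := (hcover ▸ Set.mem_univ y : y ∈ Z ∪ ⋃ e, M e)
        · exact (hyO (Or.inl (hT h))).elim
        · obtain ⟨e', he'⟩ := Set.mem_iUnion.1 h
          by_cases hee : e' = e
          · exact hee ▸ he'
          · exact (hyO (Or.inr (Set.mem_iUnion₂.2 ⟨e', hee, he'⟩))).elim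
      refine (finite_image_sub_of_isCompact ((hUo x).inter (hM e))
        ((hs x).mono Set.inter_subset_left) ((ht e).mono Set.inter_subset_right)
        ((hAc x).diff hO) hsub).subset (Set.image_mono ?_)
      rintro y ⟨hyA, hyM, hyB⟩
      refine ⟨interior_subset hyA, ?_⟩
      rintro (h | h)
      · exact hyB (Set.iUnion₂_mono (fun x _ => interior_subset) h)
      · obtain ⟨e', he', h'⟩ := Set.mem_iUnion₂.1 h
        exact (hdisj e' e he').le_bot ⟨h', hyM⟩
    rintro (x | e) (x' | e')
    · refine (finite_image_sub_of_isCompact ((hUo x).inter (hUo x'))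
        ((hs x).mono Set.inter_subset_left) ((hs x').mono Set.inter_subset_right)
        ((hAc x).inter (hAc x')) (Set.inter_subset_inter (hAU x) (hAU x'))).subset
        (Set.image_mono (Set.inter_subset_inter interior_subset interior_subset))
    · exact hmixed x e'
    · refine ((hmixed x' e).image Neg.neg).subset ?_
      rintro _ ⟨y, ⟨hy, hy'⟩, rfl⟩
      exact ⟨_, ⟨y, ⟨hy', hy⟩, rfl⟩, neg_sub _ _⟩
    · by_cases hee : e = e'
      · subst hee
        refine (Set.finite_singleton 0).subset ?_
        rintro _ ⟨y, -, rfl⟩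
        exact sub_self _
      · have : V (Sum.inr e) ∩ V (Sum.inr e') = ∅ :=
          ((hdisj e e' hee).mono Set.sdiff_subset Set.sdiff_subset).inter_eq
        rw [this, Set.image_empty]
        exact Set.finite_empty

end Gluing

/-! ### From reduced chains to homology modulo torsion -/

theorem finite_of_injective_fg {M N : Type*} [AddCommGroup M] [inst : Module ℤ M] [AddCommGroup N]
    {F : Submodule ℤ N} (hF : F.FG) (g : M →+ N) (hg : Function.Injective g)
    (hgF : ∀ x, g x ∈ F) : Module.Finite ℤ M := by
  obtain rfl : inst = AddCommGroup.toIntModule M := Subsingleton.elim _ _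
  have : Module.Finite ℤ F := Module.Finite.iff_fg.2 hF
  exact Module.Finite.of_injective (g.toIntLinearMap.codRestrict F hgF)
    fun x y h => hg (congrArg Subtype.val h)

/-- This embeds `H₁(X) / Tors` in `ReducedChains X`. -/
theorem mkQ_cycleChain_eq_iff {X : Type u} [TopologicalSpace X]
    (z z' : (singularChains X).cycles 1) :
    (weakBoundaries X).mkQ (cycleChain z) = (weakBoundaries X).mkQ (cycleChain z') ↔
      (Submodule.Quotient.mk (((singularChains X).homologyπ 1).hom z) : H₁ModTors X) =
        Submodule.Quotient.mk (((singularChains X).homologyπ 1).hom z') := by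
  rw [Submodule.Quotient.eq, ← map_sub, homologyπ_mem_torsion_iff, Submodule.mkQ_apply,
    Submodule.mkQ_apply, Submodule.Quotient.eq]
  have : cycleChain (z - z') = cycleChain z - cycleChain z' := by
    simp only [cycleChain, map_sub]
  rw [this]

theorem cycleChain_add {X : Type u} [TopologicalSpace X]
    (z z' : (singularChains X).cycles 1) :
    cycleChain (z + z') = cycleChain z + cycleChain z' := by
  simp only [cycleChain, map_add]

theorem exists_cycle_mk_eq {X : Type u} [TopologicalSpace X] (h : H₁ModTors X) :
    ∃ z : (singularChains X).cycles 1,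
      (Submodule.Quotient.mk (((singularChains X).homologyπ 1).hom z) : H₁ModTors X) = h := by
  obtain ⟨y, rfl⟩ := Submodule.Quotient.mk_surjective _ h
  obtain ⟨z, rfl⟩ := homologyπ_surjective X y
  exact ⟨z, rfl⟩

theorem finite_H₁ModTors {X : Type u} [TopologicalSpace X] {F : Submodule ℤ (ReducedChains X)}
    (hF : F.FG) (hz : ∀ z, bdry X 0 z = 0 → (weakBoundaries X).mkQ z ∈ F) :
    Module.Finite ℤ (H₁ModTors X) := by
  choose r hr using exists_cycle_mk_eq (X := X)
  -- Additive although the representatives `r h` are arbitrary, because the reduced class depends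
  -- only on `h`.
  let g : H₁ModTors X →+ ReducedChains X := AddMonoidHom.mk'
    (fun h => (weakBoundaries X).mkQ (cycleChain (r h))) fun h h' => by
      rw [← map_add, ← cycleChain_add, mkQ_cycleChain_eq_iff, hr, map_add,
        Submodule.Quotient.mk_add, hr, hr]
  refine finite_of_injective_fg hF g (fun h h' hh => ?_) fun h => hz _ (bdry_cycleChain _)
  have := (mkQ_cycleChain_eq_iff _ _).1 hh
  rwa [hr, hr] at this

/-- Points of a manifold have neighbourhoods with potentials. -/
theorem exists_isPotential_nhd {n : ℕ} {X : Type u} [TopologicalSpace X]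
    [ChartedSpace (EuclideanSpace ℝ (Fin n)) X] (x : X) :
    ∃ U, IsOpen U ∧ x ∈ U ∧ ∃ s, IsPotential U s := by
  let e := chartAt (EuclideanSpace ℝ (Fin n)) x
  obtain ⟨r, hr, hball⟩ := Metric.isOpen_iff.1 e.open_target (e x) (mem_chart_target _ x)
  -- A ball is convex, hence contractible, so its first homology vanishes and is in particular
  -- torsion.
  let W := Metric.ball (e x) r
  have hcon : ContractibleSpace W :=
    (convex_ball _ _).contractibleSpace ⟨e x, Metric.mem_ball_self hr⟩
  have hW : Module.IsTorsion ℤ (H₁ W) := fun {z} =>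
    ⟨1, by
      have := subsingleton_H₁_of_contractible W
      exact Subsingleton.elim _ _⟩
  let φ : C(W, X) := ⟨fun w => e.symm w, e.continuousOn_symm.comp_continuous
    continuous_subtype_val fun w => hball w.2⟩
  have hφ : Topology.IsEmbedding φ :=
    e.symm.isOpenEmbedding_restrict.isEmbedding.comp (Topology.IsEmbedding.inclusion hball)
  obtain ⟨s, hs⟩ := exists_isPotential_range hW hφ
  refine ⟨e.symm '' W, e.symm.isOpen_image_of_subset_source Metric.isOpen_ball hball,
    ⟨e x, Metric.mem_ball_self hr, e.left_inv (mem_chart_source _ x)⟩, s, ?_⟩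
  rwa [Set.image_eq_range]

/-! ### The first homology of a manifold with periodic ends -/

section Ends

variable {n : ℕ} {X : Type u} [TopologicalSpace X] [ChartedSpace (EuclideanSpace ℝ (Fin n)) X]
  {E : Type} {W : E → Type v} [∀ e, TopologicalSpace (W e)]
  [∀ e, ChartedSpace (EuclideanSpace ℝ (Fin n)) (W e)] {S : ∀ e, PeriodicSegment n (W e)}

theorem PeriodicEndStructure.isOpenEmbedding_φ (P : PeriodicEndStructure n X S) (e : E)
    (k : ℕ) :
    Topology.IsOpenEmbedding (P.φ e k) :=
  .of_continuous_injective_isOpenMap (P.isLocalDiffeomorph_φ e k).contMDiff.continuous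
    (P.injective_φ e k) (P.isLocalDiffeomorph_φ e k).isOpenMap

/-- Identifies the overlap as a copy of the connected set `N₊`, which is what allows potentials to
be matched along an end. -/
theorem PeriodicEndStructure.range_inter_range_succ (P : PeriodicEndStructure n X S) (e : E)
    (k : ℕ) :
    Set.range (P.φ e k) ∩ Set.range (P.φ e (k + 1)) = P.φ e k '' (S e).Npos := by
  ext y
  constructor
  · rintro ⟨⟨x, rfl⟩, x', hx'⟩
    obtain ⟨h, -⟩ := (P.φ_eq_φ_succ_iff e k x x').1 hx'.symm
    exact ⟨x, h, rfl⟩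
  · rintro ⟨x, hx, rfl⟩
    exact ⟨⟨x, rfl⟩, _, ((P.φ_eq_φ_succ_iff e k x _).2 ⟨hx, rfl⟩).symm⟩

theorem PeriodicEndStructure.exists_isPotential_end (P : PeriodicEndStructure n X S)
    [∀ e, ConnectedSpace (W e)] (hW : ∀ e, Module.IsTorsion ℤ (H₁ (W e))) (e : E) :
    ∃ s, IsPotential (⋃ k, Set.range (P.φ e k)) s := by
  have : LocallyPathConnectedSpace (W e) :=
    ChartedSpace.locallyPathConnectedSpace (EuclideanSpace ℝ (Fin n)) (W e)
  have : PathConnectedSpace (W e) := PathConnectedSpace.of_locallyPathConnectedSpace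
  refine exists_isPotential_iUnion_nat (fun k => (P.isOpenEmbedding_φ e k).isOpen_range)
    (fun k => ?_) (fun k => ?_) fun k l => P.disjoint_copies e k l
  · exact exists_isPotential_range (hW e)
      (φ := ⟨P.φ e k, (P.isOpenEmbedding_φ e k).continuous⟩) (P.isOpenEmbedding_φ e k).isEmbedding
  · rw [P.range_inter_range_succ]
    exact ((S e).Npos.isOpen.isConnected_iff_isPathConnected.1 (S e).isConnected_Npos).image
      (P.isOpenEmbedding_φ e k).continuous

theorem PeriodicEndStructure.finite_H₁ModTors (P : PeriodicEndStructure n X S)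
    [T2Space X] [Finite E] [∀ e, ConnectedSpace (W e)] (hW : ∀ e, Module.IsTorsion ℤ (H₁ (W e))) :
    Module.Finite ℤ (H₁ModTors X) := by
  have : LocallyPathConnectedSpace X :=
    ChartedSpace.locallyPathConnectedSpace (EuclideanSpace ℝ (Fin n)) X
  have : LocallyCompactSpace X :=
    ChartedSpace.locallyCompactSpace (EuclideanSpace ℝ (Fin n)) X
  obtain ⟨F, hF, hz⟩ := exists_fg_of_isCompact (X := X) (exists_isPotential_nhd (n := n))
    P.isCompact_K_diff_N (M := fun e => ⋃ k, Set.range (P.φ e k))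
    (fun e => isOpen_iUnion fun k => (P.isOpenEmbedding_φ e k).isOpen_range)
    (fun e e' hee => by
      simp only [Set.disjoint_iUnion_left, Set.disjoint_iUnion_right]
      exact fun k k' => P.disjoint_ends e e' k' k hee)
    (by
      refine Set.eq_univ_of_forall fun x => ?_
      by_cases hx : x ∈ ⋃ e, ⋃ k, Set.range (P.φ e k)
      · exact Or.inr hx
      · refine Or.inl ⟨?_, fun h => hx ?_⟩
        · exact (P.cover.ge (Set.mem_univ x)).resolve_right hx
        · obtain ⟨e, y, -, hy⟩ := Set.mem_iUnion.1 h
          exact Set.mem_iUnion₂.2 ⟨e, 0, y, hy⟩)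
    (P.exists_isPotential_end hW)
  exact PeriodicEnds.finite_H₁ModTors hF hz

theorem PeriodicEndStructure.IsEndFunction.continuous [Fintype E] {P : PeriodicEndStructure n X S}
    {τ : X → ℝ} (h : P.IsEndFunction τ) : Continuous τ := by
  obtain ⟨τ', hτ', -, -, h⟩ := h
  rw [funext h]
  exact continuous_finsetSum _ fun e _ => (hτ' e).continuous

end Ends

/-! ### Sublevel sets -/

section Sublevel

variable {X : Type u} [TopologicalSpace X]

theorem exists_bound_support {τ : X → ℝ} (hτ : Continuous τ) {k : ℕ} (c : Ch X k) :
    ∃ b, ∀ σ ∈ c.support, ∀ t, τ (σ t) ≤ b := by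
  have h : ∀ σ : C(Simp k, X), ∃ b, ∀ t, τ (σ t) ≤ b := fun σ => by
    obtain ⟨b, hb⟩ := (isCompact_range (hτ.comp σ.continuous)).bddAbove
    exact ⟨b, fun t => hb ⟨t, rfl⟩⟩
  choose b hb using h
  obtain ⟨B, hB⟩ := (c.support.finite_toSet.image b).bddAbove
  exact ⟨B, fun σ hσ t => (hb σ t).trans (hB ⟨σ, hσ, rfl⟩)⟩

/-- Finitely many homology classes are carried by a sublevel set. -/
theorem exists_forall_surjective_sublevel (hfin : Module.Finite ℤ (H₁ModTors X)) {τ : X → ℝ}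
    (hτ : Continuous τ) :
    ∃ a₀ : ℝ, 0 ≤ a₀ ∧ ∀ a ≥ a₀, Function.Surjective fun z : H₁ {x : X // τ x ≤ a} =>
      (Submodule.Quotient.mk
        (H₁.map (⟨Subtype.val, continuous_subtype_val⟩ : C({x : X // τ x ≤ a}, X)) z) :
        H₁ModTors X) := by
  obtain ⟨G, hG⟩ := hfin.fg_top
  choose r hr using exists_cycle_mk_eq (X := X)
  choose b hb using fun h => exists_bound_support hτ (cycleChain (r h))
  obtain ⟨B, hB⟩ := (G.finite_toSet.image b).bddAbove
  -- `B` bounds `τ` on the cycles chosen to represent the finitely many generators.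
  refine ⟨max 0 B, le_max_left _ _, fun a ha => ?_⟩
  let ι : C({x : X // τ x ≤ a}, X) := ⟨Subtype.val, continuous_subtype_val⟩
  let f : H₁ {x : X // τ x ≤ a} →+ H₁ModTors X :=
    (Submodule.torsion ℤ (H₁ X)).mkQ.toAddMonoidHom.comp (H₁.map ι).toAddMonoidHom
  suffices hle : Submodule.span ℤ G ≤ AddSubgroup.toIntSubmodule f.range from
    fun h => hle (hG ▸ Submodule.mem_top)
  rw [Submodule.span_le]
  intro h hh
  have hι : Topology.IsEmbedding ι := Topology.IsEmbedding.subtypeVal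
  obtain ⟨c, hc⟩ := exists_chMap_eq hι (cycleChain (r h)) fun σ hσ => by
    rintro _ ⟨t, rfl⟩
    exact ⟨⟨σ t, ((hb h σ hσ t).trans (hB ⟨h, hh, rfl⟩)).trans
      ((le_max_right _ _).trans ha)⟩, rfl⟩
  have hc0 : bdry _ 0 c = 0 := chMap_injective hι.injective 0 (by
    rw [← bdry_chMap, hc, bdry_cycleChain, map_zero])
  obtain ⟨z, rfl⟩ := exists_cycleChain_eq c hc0
  refine ⟨((singularChains _).homologyπ 1).hom z, ?_⟩
  exact (congrArg (Submodule.torsion ℤ (H₁ X)).mkQ (H₁.map_homologyπ ι z (r h) hc)).trans (hr h)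

end Sublevel

/-! ### Evaluation of cocycles on cycles -/

/-- An additive map, as a linear map for arbitrary `ℤ`-module structures. -/
def intLinearMap {M A : Type*} [AddCommGroup M] [Module ℤ M] [AddCommGroup A] [Module ℤ A]
    (g : M →+ A) : M →ₗ[ℤ] A where
  toFun := g
  map_add' := map_add g
  map_smul' m x := (congrArg g (int_smul_eq_zsmul _ m x)).trans
    ((map_zsmul g m x).trans (int_smul_eq_zsmul _ m (g x)).symm)

section Evaluation

variable {X : Type u} [TopologicalSpace X]

/-- A nonzero multiple of `z - z'` is a boundary, on which a cocycle vanishes; torsion-freeness of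
`A` removes the multiple. -/
theorem cochain_eq_of_mk_eq {R : Type} [CommRing R] {A : Type v} [AddCommGroup A] [Module R A]
    (hA : ∀ (m : ℤ) (a : A), m ≠ 0 → m • a = 0 → a = 0) (c : cocycles₁ R X A)
    {z z' : (singularChains X).cycles 1}
    (h : (Submodule.Quotient.mk (((singularChains X).homologyπ 1).hom z) : H₁ModTors X) =
        Submodule.Quotient.mk (((singularChains X).homologyπ 1).hom z')) :
    c.1 (((singularChains X).iCycles 1).hom z) = c.1 (((singularChains X).iCycles 1).hom z') := by
  rw [← mkQ_cycleChain_eq_iff, Submodule.mkQ_apply, Submodule.mkQ_apply, Submodule.Quotient.eq,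
    mem_weakBoundaries] at h
  obtain ⟨m, hm, w, hw⟩ := h
  obtain ⟨w, rfl⟩ := (chainEquiv X 2).surjective w
  have hc : c.1 ∘ₗ ((singularChains X).d 2 1).hom = 0 := c.2
  have hw' : ((singularChains X).d 2 1).hom w =
      m • (((singularChains X).iCycles 1).hom z - ((singularChains X).iCycles 1).hom z') := by
    apply (chainEquiv X 1).injective
    rw [chainEquiv_d, hw, map_zsmul, map_sub]
    rfl
  have h0 := LinearMap.congr_fun hc w
  rw [LinearMap.comp_apply, hw', LinearMap.zero_apply, map_zsmul] at h0
  rw [← sub_eq_zero, ← map_sub]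
  exact hA m _ hm h0

/-- Evaluation of cocycles on homology classes modulo torsion. -/
theorem exists_evaluation (R : Type) [CommRing R] (X : Type u) [TopologicalSpace X]
    (A : Type v) [AddCommGroup A] [Module R A]
    (hA : ∀ (m : ℤ) (a : A), m ≠ 0 → m • a = 0 → a = 0) :
    ∃ ev : cocycles₁ R X A →ₗ[R] (H₁ModTors X →ₗ[ℤ] A), ∀ c z,
      ev c (Submodule.Quotient.mk (((singularChains X).homologyπ 1).hom z)) =
        c.1 (((singularChains X).iCycles 1).hom z) := by
  choose r hr using exists_cycle_mk_eq (X := X)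
  refine ⟨
    { toFun := fun c => intLinearMap (AddMonoidHom.mk'
        (fun h => c.1 (((singularChains X).iCycles 1).hom (r h))) fun h h' => ?_)
      map_add' := fun c d => rfl
      map_smul' := fun m c => rfl }, fun c z => ?_⟩
  · rw [← map_add, ← map_add]
    apply cochain_eq_of_mk_eq hA
    rw [map_add, Submodule.Quotient.mk_add, hr, hr, hr]
  · exact cochain_eq_of_mk_eq hA c (hr _)

/-- The choice of a path to each point of a path connected space, as a map on chains. -/
theorem exists_cone [PathConnectedSpace X] :
    ∃ T : Ch X 0 →ₗ[ℤ] Ch X 1, ∀ c, bdry X 0 (T (bdry X 0 c)) = bdry X 0 c := by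
  let p : X := Classical.arbitrary X
  let T : Ch X 0 →ₗ[ℤ] Ch X 1 := Finsupp.linearCombination ℤ fun q =>
    Finsupp.single (pathSimplex (PathConnectedSpace.somePath p (q default))) 1
  -- The base point terms cancel on boundaries of 1-chains.
  have hT : ∀ x, bdry X 0 (T (pt x)) = pt x - pt p := fun x => by
    simp only [T, pt, Finsupp.linearCombination_single, one_smul, ContinuousMap.const_apply]
    rw [bdry_zero_single, src_pathSimplex, tgt_pathSimplex]
    rfl
  refine ⟨T, fun c => ?_⟩
  have : bdry X 0 ∘ₗ T ∘ₗ bdry X 0 = bdry X 0 := by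
    ext1 σ
    ext1
    simp only [LinearMap.comp_apply, Finsupp.lsingle_apply, bdry_zero_single, map_sub, hT]
    abel
  exact LinearMap.congr_fun this c

/-- By `exists_cone`, `c ↦ c - T (∂ c)` is a projection of 1-chains onto cycles. A cocycle vanishing
on cycles therefore equals its composite with `T ∘ ∂`, a coboundary; and a functional on `H₁(X) /
Tors` extends to a cocycle by composition with the projection. -/
theorem evaluationIsIso [PathConnectedSpace X] (R : Type) [CommRing R]
    (A : Type v) [AddCommGroup A] [Module R A]
    (hA : ∀ (m : ℤ) (a : A), m ≠ 0 → m • a = 0 → a = 0) : EvaluationIsIso R X A := by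
  obtain ⟨ev, hev⟩ := exists_evaluation R X A hA
  obtain ⟨T, hT⟩ := exists_cone (X := X)
  have hle : coboundaries₁ R X A ≤ LinearMap.ker ev := by
    rintro ⟨c, hc⟩ ⟨b, hb⟩
    have hb' : b ∘ₗ ((singularChains X).d 1 0).hom = c := hb
    rw [LinearMap.mem_ker]
    ext h
    obtain ⟨z, rfl⟩ := exists_cycle_mk_eq h
    rw [hev]
    change c _ = 0
    rw [← hb', LinearMap.comp_apply]
    have h0 : ((singularChains X).d 1 0).hom (((singularChains X).iCycles 1).hom z) = 0 :=
      congrArg (fun f => f.hom z) ((singularChains X).iCycles_d 1 0)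
    rw [h0, map_zero]
  have hbdry : ∀ c, bdry X 0 (c - T (bdry X 0 c)) = 0 := fun c => by
    rw [map_sub, hT, sub_self]
  choose cyc hcyc using fun c => exists_cycleChain_eq _ (hbdry c)
  have hinj : LinearMap.ker ev ≤ coboundaries₁ R X A := by
    intro c hc
    -- The 0-cochain `c ∘ T`.
    refine ⟨intLinearMap (c.1.toAddMonoidHom.comp
      (((chainEquiv X 1).symm.toLinearMap ∘ₗ T ∘ₗ (chainEquiv X 0).toLinearMap).toAddMonoidHom)),
      ?_⟩
    refine LinearMap.ext fun x => ?_
    change c.1 ((chainEquiv X 1).symm (T (chainEquiv X 0 (((singularChains X).d 1 0).hom x)))) =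
      c.1 x
    have h0 := hev c (cyc (chainEquiv X 1 x))
    rw [LinearMap.mem_ker.1 hc, LinearMap.zero_apply] at h0
    have h1 : ((singularChains X).iCycles 1).hom (cyc (chainEquiv X 1 x)) =
        x - (chainEquiv X 1).symm (T (chainEquiv X 0 (((singularChains X).d 1 0).hom x))) := by
      apply (chainEquiv X 1).injective
      refine (hcyc _).trans ?_
      rw [map_sub, LinearEquiv.apply_symm_apply, chainEquiv_d]
    rw [h1, map_sub, eq_comm, sub_eq_zero] at h0
    exact h0.symm
  have hsurj : Function.Surjective ev := by
    intro g
    let F : (singularChains X).X 1 →+ A := AddMonoidHom.mk' (fun x => g (Submodule.Quotient.mk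
      (((singularChains X).homologyπ 1).hom (cyc (chainEquiv X 1 x))))) fun x y => by
        rw [← map_add, ← Submodule.Quotient.mk_add, ← map_add]
        congr 3
        apply cycleChain_injective
        rw [cycleChain_add, hcyc, hcyc, hcyc]
        simp only [map_add]
        abel
    refine ⟨⟨intLinearMap F, ?_⟩, ?_⟩
    · refine LinearMap.ext fun w => ?_
      change g (Submodule.Quotient.mk (((singularChains X).homologyπ 1).hom
        (cyc (chainEquiv X 1 (((singularChains X).d 2 1).hom w))))) = 0
      -- The projection fixes the boundary of `w`, whose homology class is zero.
      rw [(homologyπ_eq_zero_iff _).2, Submodule.Quotient.mk_zero, map_zero]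
      refine ⟨chainEquiv X 2 w, ?_⟩
      rw [hcyc, chainEquiv_d, bdry_bdry, map_zero, sub_zero]
    · ext h
      obtain ⟨z, rfl⟩ := exists_cycle_mk_eq h
      rw [hev]
      change g (Submodule.Quotient.mk (((singularChains X).homologyπ 1).hom
        (cyc (cycleChain z)))) = _
      congr 3
      apply cycleChain_injective
      rw [hcyc, bdry_cycleChain, map_zero, sub_zero]
  let L := (coboundaries₁ R X A).liftQ ev hle
  have hL : Function.Bijective L := by
    constructor
    · rw [← LinearMap.ker_eq_bot]
      exact Submodule.ker_liftQ_eq_bot _ _ _ hinj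
    · intro g
      obtain ⟨c, hc⟩ := hsurj g
      exact ⟨Submodule.Quotient.mk c, hc⟩
  exact ⟨LinearEquiv.ofBijective L hL, hev⟩

end Evaluation

/-! ### Integral and real cohomology -/

section Lattice

variable {X : Type u} [TopologicalSpace X]

theorem eq_zero_of_zsmul_eq_zero {A : Type*} [AddCommGroup A] {ι : Type*}
    (b : Module.Basis ι ℤ A) (m : ℤ) (a : A) (hm : m ≠ 0) (h : m • a = 0) : a = 0 := by
  have : Module.IsTorsionFree ℤ A := b.isTorsionFree
  exact (smul_eq_zero.1 h).resolve_left hm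

theorem free_H₁ModTors (hfin : Module.Finite ℤ (H₁ModTors X)) : Module.Free ℤ (H₁ModTors X) := by
  have : IsAddTorsionFree (H₁ModTors X) := @IsAddTorsionFree.of_isTorsionFree ℤ _ _ _
    (Submodule.Quotient.module _) Submodule.QuotientTorsion.instIsTorsionFree _ _
  infer_instance

/-- Naturality of evaluation: it turns the change of coefficients into composition with `g`. -/
theorem coeffMap_evaluation {A B : Type v} [AddCommGroup A] [AddCommGroup B] [Module ℝ B]
    (g : A →ₗ[ℤ] B) {Ψ : Cohomology₁ ℤ X A → (H₁ModTors X →ₗ[ℤ] A)}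
    {Φ : Cohomology₁ ℝ X B → (H₁ModTors X →ₗ[ℤ] B)}
    (hΨ : ∀ (c : cocycles₁ ℤ X A) (z : (singularChains X).cycles 1),
      Ψ (Submodule.Quotient.mk c)
          (Submodule.Quotient.mk (((singularChains X).homologyπ 1).hom z)) =
        c.1 (((singularChains X).iCycles 1).hom z))
    (hΦ : ∀ (c : cocycles₁ ℝ X B) (z : (singularChains X).cycles 1),
      Φ (Submodule.Quotient.mk c)
          (Submodule.Quotient.mk (((singularChains X).homologyπ 1).hom z)) =
        c.1 (((singularChains X).iCycles 1).hom z)) (x : Cohomology₁ ℤ X A) :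
    Φ (coeffMap ℝ X g x) = g ∘ₗ Ψ x := by
  obtain ⟨c, rfl⟩ := Submodule.Quotient.mk_surjective _ x
  ext h
  obtain ⟨z, rfl⟩ := exists_cycle_mk_eq h
  rw [LinearMap.comp_apply, hΨ]
  exact hΦ _ z

/-- A map of coefficients which sends a generator of an infinite cyclic group to a generator of a
real line maps a basis of the integral cohomology to a basis of the real cohomology. -/
theorem exists_basis_coeffMap [PathConnectedSpace X] (hfin : Module.Finite ℤ (H₁ModTors X))
    {A B : Type v} [AddCommGroup A] [AddCommGroup B] [Module ℝ B] (g : A →ₗ[ℤ] B)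
    (bA : Module.Basis Unit ℤ A) (bB : Module.Basis Unit ℝ B) (hg : g (bA ()) = bB ()) :
    Function.Injective (coeffMap ℝ X g) ∧
    ∃ (r : ℕ) (b : Module.Basis (Fin r) ℤ (Cohomology₁ ℤ X A))
      (b' : Module.Basis (Fin r) ℝ (Cohomology₁ ℝ X B)), ∀ i, coeffMap ℝ X g (b i) = b' i := by
  have hB : ∀ (m : ℤ) (a : B), m ≠ 0 → m • a = 0 → a = 0 := fun m a hm h => by
    have : Module.IsTorsionFree ℝ B := bB.isTorsionFree
    rw [← Int.cast_smul_eq_zsmul ℝ] at h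
    exact (smul_eq_zero.1 h).resolve_left (Int.cast_ne_zero.2 hm)
  obtain ⟨Ψ, hΨ⟩ := evaluationIsIso (X := X) ℤ A (eq_zero_of_zsmul_eq_zero bA)
  obtain ⟨Φ, hΦ⟩ := evaluationIsIso (X := X) ℝ B hB
  have hnat := coeffMap_evaluation g hΨ hΦ
  have hginj : Function.Injective g := by
    rw [injective_iff_map_eq_zero]
    intro a ha
    have h1 : a = bA.repr a () • bA () := by
      conv_lhs => rw [← bA.sum_repr a]
      simp
    rw [h1, map_smul, hg] at ha
    by_contra hne
    have h2 : bA.repr a () ≠ 0 := fun h => hne (by rw [h1, h, zero_smul])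
    exact bB.ne_zero () (hB _ _ h2 ha)
  refine ⟨fun x y hxy => Ψ.injective ?_, ?_⟩
  · have := (hnat x).symm.trans ((congrArg Φ hxy).trans (hnat y))
    ext h
    exact hginj (LinearMap.congr_fun this h)
  have := free_H₁ModTors hfin
  let h := Module.finBasis ℤ (H₁ModTors X)
  let r := Module.finrank ℤ (H₁ModTors X)
  let eA : (H₁ModTors X →ₗ[ℤ] A) ≃ₗ[ℤ] (Fin r → ℤ) := (h.constr ℤ).symm ≪≫ₗ
    LinearEquiv.piCongrRight fun _ => bA.equivFun ≪≫ₗ LinearEquiv.funUnique Unit ℤ ℤ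
  let eB : (H₁ModTors X →ₗ[ℤ] B) ≃ₗ[ℝ] (Fin r → ℝ) := (h.constr ℝ).symm ≪≫ₗ
    LinearEquiv.piCongrRight fun _ => bB.equivFun ≪≫ₗ LinearEquiv.funUnique Unit ℝ ℝ
  -- The unit vectors correspond to the functionals dual to `h`, scaled by the generator; `g`
  -- carries one scaled dual basis to the other.
  have heA : ∀ i j, eA.symm (Pi.single i 1) (h j) = if i = j then bA () else 0 := by
    intro i j
    by_cases hij : i = j
    · subst hij
      simp [eA]
    · simp [eA, hij]
  have heB : ∀ i j, eB.symm (Pi.single i 1) (h j) = if i = j then bB () else 0 := by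
    intro i j
    by_cases hij : i = j
    · subst hij
      simp [eB]
    · simp [eB, hij]
  refine ⟨r, .ofEquivFun (Ψ ≪≫ₗ eA), .ofEquivFun (Φ ≪≫ₗ eB), fun i => Φ.injective ?_⟩
  rw [hnat]
  refine h.ext fun j => ?_
  simp only [Module.Basis.coe_ofEquivFun, LinearEquiv.trans_symm, LinearEquiv.trans_apply,
    LinearEquiv.apply_symm_apply, LinearMap.comp_apply, heA, heB]
  split_ifs <;> simp [hg]

theorem tensorMap_bijective [PathConnectedSpace X] (hfin : Module.Finite ℤ (H₁ModTors X)) :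
    Function.Bijective (tensorMap X) := by
  obtain ⟨-, r, b, b', hb⟩ := exists_basis_coeffMap hfin (Algebra.linearMap ℤ ℝ)
    (Module.Basis.singleton Unit ℤ) (Module.Basis.singleton Unit ℝ) (by simp)
  have : tensorMap X = ((b.baseChange ℝ).equiv b' (Equiv.refl _)).toLinearMap := by
    refine (b.baseChange ℝ).ext fun i => ?_
    rw [LinearEquiv.coe_coe, Module.Basis.equiv_apply, Equiv.refl_apply, ← hb,
      Module.Basis.baseChange_apply, tensorMap, LinearMap.liftBaseChange_tmul, one_smul]
  rw [this]
  exact LinearEquiv.bijective _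

theorem coeffMap_twoPiI [PathConnectedSpace X] (hfin : Module.Finite ℤ (H₁ModTors X)) :
    Function.Injective (coeffMap ℝ X twoPiIIntInclusion) ∧
    ∃ (r : ℕ) (b : Module.Basis (Fin r) ℝ (Cohomology₁ ℝ X imaginaryLine)),
      LinearMap.range (coeffMap ℝ X twoPiIIntInclusion) = Submodule.span ℤ (Set.range b) := by
  have hne : (2 * Real.pi * Complex.I : ℂ) ≠ 0 := Complex.two_pi_I_ne_zero
  -- The real line is generated anew by `2πi`, so that one vector serves as basis of both
  -- coefficient modules.
  have hspan : imaginaryLine = Submodule.span ℝ {(2 * Real.pi * Complex.I : ℂ)} := by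
    have : (2 * Real.pi * Complex.I : ℂ) = (2 * Real.pi : ℝ) • Complex.I := by simp
    rw [this, Submodule.span_singleton_smul_eq (isUnit_iff_ne_zero.2 Real.two_pi_pos.ne')]
    rfl
  let bA : Module.Basis Unit ℤ twoPiIInt := (Module.Basis.singleton Unit ℤ).map
    (LinearEquiv.toSpanNonzeroSingleton ℤ ℂ _ hne)
  let bB : Module.Basis Unit ℝ imaginaryLine := (Module.Basis.singleton Unit ℝ).map
    (LinearEquiv.toSpanNonzeroSingleton ℝ ℂ _ hne ≪≫ₗ LinearEquiv.ofEq _ _ hspan.symm)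
  have hbA : (bA () : ℂ) = 2 * Real.pi * Complex.I := by
    change ((LinearEquiv.toSpanNonzeroSingleton ℤ ℂ _ hne
      (Module.Basis.singleton Unit ℤ ()) : _) : ℂ) = _
    simp
  obtain ⟨hinj, r, b, b', hb⟩ := exists_basis_coeffMap hfin twoPiIIntInclusion bA bB
    (Subtype.ext (by simp [hbA, bB, twoPiIIntInclusion]))
  refine ⟨hinj, r, b', ?_⟩
  rw [LinearMap.range_eq_map, ← b.span_eq, Submodule.map_span, ← Set.range_comp]
  congr 2
  exact funext hb

end Lattice

end PeriodicEnds

end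

theorem mainTheorem10 {n : ℕ} {X : Type u} [TopologicalSpace X] [T2Space X]
    [SecondCountableTopology X] [ConnectedSpace X] [ChartedSpace (EuclideanSpace ℝ (Fin n)) X]
    [IsManifold (𝓡 n) ∞ X]
    {E : Type} [Fintype E] {W : E → Type v}
    [∀ e, TopologicalSpace (W e)] [∀ e, T2Space (W e)] [∀ e, SecondCountableTopology (W e)]
    [∀ e, ConnectedSpace (W e)] [∀ e, NoncompactSpace (W e)]
    [∀ e, ChartedSpace (EuclideanSpace ℝ (Fin n)) (W e)] [∀ e, IsManifold (𝓡 n) ∞ (W e)]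
    {S : ∀ e, PeriodicEnds.PeriodicSegment n (W e)} (P : PeriodicEnds.PeriodicEndStructure n X S)
    (hW : ∀ e, Module.IsTorsion ℤ (PeriodicEnds.H₁ (W e))) :
    -- surjectivity for all large `a`, in particular for all large regular values `a` of `τ`
    (∀ τ : X → ℝ, P.IsEndFunction τ → ∃ a₀ : ℝ, 0 ≤ a₀ ∧ ∀ a ≥ a₀,
      Function.Surjective fun z : PeriodicEnds.H₁ {x : X // τ x ≤ a} =>
        (Submodule.Quotient.mk
          (PeriodicEnds.H₁.map (⟨Subtype.val, continuous_subtype_val⟩ : C({x : X // τ x ≤ a}, X)) z) :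
          PeriodicEnds.H₁ModTors X)) ∧
    Module.Finite ℤ (PeriodicEnds.H₁ModTors X) ∧
    PeriodicEnds.EvaluationIsIso ℤ X ℤ ∧
    PeriodicEnds.EvaluationIsIso ℝ X ℝ ∧
    Function.Bijective (PeriodicEnds.tensorMap X) ∧
    -- `H¹(X, 2πiℤ)` is a lattice in the finite-dimensional space `H¹(X, iℝ)`
    Function.Injective
      (PeriodicEnds.coeffMap ℝ X PeriodicEnds.twoPiIIntInclusion) ∧
    ∃ (r : ℕ) (b : Module.Basis (Fin r) ℝ
        (PeriodicEnds.Cohomology₁ ℝ X PeriodicEnds.imaginaryLine)),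
      LinearMap.range (PeriodicEnds.coeffMap ℝ X PeriodicEnds.twoPiIIntInclusion) =
        Submodule.span ℤ (Set.range b) := by
  have : LocallyPathConnectedSpace X :=
    ChartedSpace.locallyPathConnectedSpace (EuclideanSpace ℝ (Fin n)) X
  have : PathConnectedSpace X := PathConnectedSpace.of_locallyPathConnectedSpace
  have hfin := P.finite_H₁ModTors hW
  exact ⟨fun τ hτ => PeriodicEnds.exists_forall_surjective_sublevel hfin hτ.continuous, hfin,
    PeriodicEnds.evaluationIsIso ℤ ℤ fun m a hm h => (mul_eq_zero.1 h).resolve_left hm,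
    PeriodicEnds.evaluationIsIso ℝ ℝ fun m a hm h => (smul_eq_zero.1 h).resolve_left hm,
    PeriodicEnds.tensorMap_bijective hfin, PeriodicEnds.coeffMap_twoPiI hfin⟩
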